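/- All manifolds and maps are smooth, manifolds are finite-dimensional, Hausdorff and second countable, and Riemannian manifolds are connected. A *Riemannian regular $\sigma$-manifold of order $k$* is a connected Riemannian manifold $(M,g)$ with a family of isometries $s_x : M\to M$ ($x\in M$) such that $s_x(x)=x$ for all $x$, and the tensor field $S$ given by $S_x=(s_x)_{*x}$ is smooth, invariant under every $s_y$, and satisfies $S^k=I$. Let $G$ be a connected Lie group, $k\ge 1$, $\sigma$ an automorphism of the Lie group $G$ with $\sigma^k=\mathrm{id}$, $G^\sigma=\{a\in G:\sigma(a)=a\}$, and $G^\sigma_0$ the identity component of $G^\sigma$. Let $H$ be a closed subgroup of $G$ with $G^\sigma_0\subset H\subset G^\sigma$, and let $N=G/H$ carry a Riemannian metric $g^2$ for which $G$ acts on $N$ by isometries and the symmetries $s_{aH}(bH)=a\,\sigma(a)^{-1}\sigma(b)H$ are isometries (that is, $N$ is a Riemannian regular homogeneous $s$-manifold of order $k$ defined by $\sigma$). Let $(\Lambda,g^1)$ be a connected Riemannian manifold on which $H$ acts smoothly on the left by isometries. Let $M=G\times_H\Lambda$ be the quotient of $G\times\Lambda$ by $(ah,u)\sim(a,hu)$,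 $h\in H$, and let $a\otimes u$ be the class of $(a,u)$. Theorem 4.43. The quotient $M=G\times_H\Lambda$, with the quotient topology, is Hausdorff and second countable and has a smooth manifold structure for which $G\times\Lambda\to M$, $(a,u)\mapsto a\otimes u$, is a submersion. Moreover there is a Riemannian metric $g$ on $M$ such that $u\mapsto a\otimes u$, $\Lambda\to M$, preserves the metrics for each $a\in G$, the projection $M\to N$, $a\otimes u\mapsto aH$, is a Riemannian submersion, and $(M,g)$ with the maps $s_x(y)=x\cdot y$ defined by the multiplication $$(a\otimes u)\cdot(b\otimes v)=a\,\sigma(a)^{-1}\sigma(b)\otimes v$$ is a Riemannian regular $\sigma$-manifold of order $k$. -/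

import Mathlib

open scoped Manifold ContDiff

namespace SigmaManifold

section Riemannian

/-- Smooth Riemannian metrics on a manifold `M` without boundary, modelled on the vector
space `E`: smooth families of inner products on the tangent spaces. -/
abbrev Metric (E : Type*) [NormedAddCommGroup E] [NormedSpace ℝ E]
    (M : Type*) [TopologicalSpace M] [ChartedSpace E M] [IsManifold 𝓘(ℝ, E) ∞ M] :=
  Bundle.ContMDiffRiemannianMetric 𝓘(ℝ, E) ∞ E (fun x : M => TangentSpace 𝓘(ℝ, E) x)

variable {E : Type*} [NormedAddCommGroup E] [NormedSpace ℝ E]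
  {M : Type*} [TopologicalSpace M] [ChartedSpace E M] [IsManifold 𝓘(ℝ, E) ∞ M]
  {E' : Type*} [NormedAddCommGroup E'] [NormedSpace ℝ E']
  {M' : Type*} [TopologicalSpace M'] [ChartedSpace E' M'] [IsManifold 𝓘(ℝ, E') ∞ M']

/-- The differential of `f` preserves inner products of tangent vectors. -/
def PreservesMetric (g : Metric E M) (g' : Metric E' M') (f : M → M') : Prop :=
  ∀ (x : M) (v w : TangentSpace 𝓘(ℝ, E) x),
    g'.inner (f x) (mfderiv 𝓘(ℝ, E) 𝓘(ℝ, E') f x v) (mfderiv 𝓘(ℝ, E) 𝓘(ℝ, E') f x w) =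
      g.inner x v w

/-- `f` is an isometry of the Riemannian manifold `(M, g)` onto itself: a diffeomorphism
preserving the metric. -/
def IsRiemannianIsometry (g : Metric E M) (f : M → M) : Prop :=
  (∃ Φ : M ≃ₘ^∞⟮𝓘(ℝ, E), 𝓘(ℝ, E)⟯ M, ⇑Φ = f) ∧ PreservesMetric g g f

/-- `f` is a Riemannian submersion: a smooth map whose differentials are surjective and are
isometric on the orthogonal complements of their kernels. -/
structure IsRiemannianSubmersion (g : Metric E M) (g' : Metric E' M') (f : M → M') : Prop where
  contMDiff : ContMDiff 𝓘(ℝ, E) 𝓘(ℝ, E') ∞ f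
  surjective : ∀ x : M, Function.Surjective (mfderiv 𝓘(ℝ, E) 𝓘(ℝ, E') f x)
  isometric : ∀ (x : M) (v w : TangentSpace 𝓘(ℝ, E) x),
    (∀ z : TangentSpace 𝓘(ℝ, E) x, mfderiv 𝓘(ℝ, E) 𝓘(ℝ, E') f x z = 0 → g.inner x v z = 0) →
    (∀ z : TangentSpace 𝓘(ℝ, E) x, mfderiv 𝓘(ℝ, E) 𝓘(ℝ, E') f x z = 0 → g.inner x w z = 0) →
    g'.inner (f x) (mfderiv 𝓘(ℝ, E) 𝓘(ℝ, E') f x v) (mfderiv 𝓘(ℝ, E) 𝓘(ℝ, E') f x w) =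
      g.inner x v w

/-- The field of endomorphisms `S` attached to a family of maps `s x : M → M` with
`s x x = x`: on the tangent space at `x` it is the differential of `s x` at `x`. It is encoded
as a map of the tangent bundle to itself, `(x, v) ↦ (s x x, d(s x)_x v)`. -/
noncomputable def symmetryTensor (E : Type*) [NormedAddCommGroup E] [NormedSpace ℝ E]
    {M : Type*} [TopologicalSpace M] [ChartedSpace E M] [IsManifold 𝓘(ℝ, E) ∞ M]
    (s : M → M → M) : TangentBundle 𝓘(ℝ, E) M → TangentBundle 𝓘(ℝ, E) M :=
  fun v => tangentMap 𝓘(ℝ, E) 𝓘(ℝ, E) (s v.proj) v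

/-- `(M, g)` with the family of maps `s x : M → M` is a Riemannian regular `σ`-manifold of
order `k`: `M` is connected, each `s x` is a (globally defined) isometry fixing `x`, and the
tensor field `S`, where `S` at `x` is the differential of `s x` at `x`, is smooth, invariant
under every `s y`, and satisfies `S ^ k = I`. -/
structure IsRegularSigmaManifold (k : ℕ) (g : Metric E M) (s : M → M → M) : Prop where
  connected : ConnectedSpace M
  isometry : ∀ x, IsRiemannianIsometry g (s x)
  fixed : ∀ x, s x x = x
  smooth : ContMDiff 𝓘(ℝ, E).tangent 𝓘(ℝ, E).tangent ∞ (symmetryTensor E s)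
  invariant : ∀ (y : M) (v : TangentBundle 𝓘(ℝ, E) M),
    tangentMap 𝓘(ℝ, E) 𝓘(ℝ, E) (s y) (symmetryTensor E s v) =
      symmetryTensor E s (tangentMap 𝓘(ℝ, E) 𝓘(ℝ, E) (s y) v)
  order : ∀ v : TangentBundle 𝓘(ℝ, E) M, (symmetryTensor E s)^[k] v = v

end Riemannian

section Bundle

variable {G : Type*} [Group G]

/-- The equivalence relation on `G × Λ` generated by `(a h, u) ∼ (a, h u)`, `h ∈ H`. -/
def assocSetoid (H : Subgroup G) (Λ : Type*) [MulAction H Λ] : Setoid (G × Λ) where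
  r p q := ∃ h : H, p.1 = q.1 * h ∧ q.2 = h • p.2
  iseqv :=
    { refl := fun p => ⟨1, by simp, by simp⟩
      symm := by
        rintro p q ⟨h, h1, h2⟩
        exact ⟨h⁻¹, by simp [h1], by simp [h2]⟩
      trans := by
        rintro p q r ⟨h, h1, h2⟩ ⟨h', h1', h2'⟩
        exact ⟨h' * h, by simp [h1, h1', mul_assoc], by simp [h2, h2', mul_smul]⟩ }

/-- The associated bundle `G ×_H Λ`, as a set. -/
def AssocBundle (H : Subgroup G) (Λ : Type*) [MulAction H Λ] : Type _ :=
  Quotient (assocSetoid H Λ)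

/-- The quotient topology on `G ×_H Λ`. -/
instance (H : Subgroup G) (Λ : Type*) [MulAction H Λ] [TopologicalSpace G]
    [TopologicalSpace Λ] : TopologicalSpace (AssocBundle H Λ) :=
  inferInstanceAs (TopologicalSpace (Quotient (assocSetoid H Λ)))

/-- The class `a ⊗ u` of `(a, u)` in `G ×_H Λ`. -/
def tmul (H : Subgroup G) {Λ : Type*} [MulAction H Λ] (a : G) (u : Λ) : AssocBundle H Λ :=
  Quotient.mk (assocSetoid H Λ) (a, u)

/-- The bundle projection `G ×_H Λ → G ⧸ H`, `a ⊗ u ↦ aH`. -/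
def assocProj (H : Subgroup G) (Λ : Type*) [MulAction H Λ] : AssocBundle H Λ → G ⧸ H :=
  Quotient.lift (fun p => (QuotientGroup.mk p.1 : G ⧸ H)) (by
    rintro p q ⟨h, h1, -⟩
    simp [h1])

/-- The multiplication `aH · bH = a σ(a)⁻¹ σ(b) H` on `G ⧸ H`, where `σ` fixes `H` pointwise. -/
def cosetMul (σ : G ≃* G) (H : Subgroup G) (hH : ∀ h ∈ H, σ h = h) :
    G ⧸ H → G ⧸ H → G ⧸ H :=
  Quotient.lift₂ (fun a b => (QuotientGroup.mk (a * (σ a)⁻¹ * σ b) : G ⧸ H)) (by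
    intro a b a' b' ha hb
    have ha' := QuotientGroup.leftRel_apply.mp ha
    have hb' := QuotientGroup.leftRel_apply.mp hb
    obtain ⟨x, hx, rfl⟩ : ∃ x ∈ H, a' = a * x := ⟨a⁻¹ * a', ha', by group⟩
    obtain ⟨y, hy, rfl⟩ : ∃ y ∈ H, b' = b * y := ⟨b⁻¹ * b', hb', by group⟩
    simp only [map_mul, hH x hx, hH y hy]
    rw [QuotientGroup.eq]
    simpa [mul_assoc] using hy)

/-- The multiplication `(a ⊗ u) · (b ⊗ v) = a σ(a)⁻¹ σ(b) ⊗ v` on `G ×_H Λ`, where `σ` fixes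
`H` pointwise. -/
def assocMul (σ : G ≃* G) (H : Subgroup G) (hH : ∀ h ∈ H, σ h = h)
    (Λ : Type*) [MulAction H Λ] : AssocBundle H Λ → AssocBundle H Λ → AssocBundle H Λ :=
  Quotient.lift₂ (fun p q => tmul H (p.1 * (σ p.1)⁻¹ * σ q.1) q.2) (by
    rintro p q p' q' ⟨h, h1, -⟩ ⟨h', h1', h2'⟩
    refine Quotient.sound ⟨h', ?_, h2'⟩
    simp [h1, h1', hH h h.2, hH h' h'.2, mul_assoc])

theorem tmul_mul (H : Subgroup G) {Λ : Type*} [MulAction H Λ] (a : G) (h : H) (u : Λ) :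
    tmul H (a * h) u = tmul H a (h • u) :=
  Quotient.sound ⟨h, rfl, rfl⟩

theorem assocProj_tmul (H : Subgroup G) {Λ : Type*} [MulAction H Λ] (a : G) (u : Λ) :
    assocProj H Λ (tmul H a u) = QuotientGroup.mk a :=
  rfl

theorem cosetMul_mk (σ : G ≃* G) (H : Subgroup G) (hH : ∀ h ∈ H, σ h = h) (a b : G) :
    cosetMul σ H hH (QuotientGroup.mk a) (QuotientGroup.mk b) =
      QuotientGroup.mk (a * (σ a)⁻¹ * σ b) :=
  rfl

theorem assocMul_tmul (σ : G ≃* G) (H : Subgroup G) (hH : ∀ h ∈ H, σ h = h)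
    {Λ : Type*} [MulAction H Λ] (a b : G) (u v : Λ) :
    assocMul σ H hH Λ (tmul H a u) (tmul H b v) = tmul H (a * (σ a)⁻¹ * σ b) v :=
  rfl

end Bundle

end SigmaManifold

/-! The map `G → G ⧸ H` has smooth local sections `s`. Each gives a trivialization `b ⊗ u ↦ (bH,
s(bH)⁻¹ b • u)` of `G ×_H Λ` over an open set of `G ⧸ H`. Two of them differ by the action on `Λ` of
an element of `H` depending smoothly on the base point, so they define the smooth structure. Since
`H` acts by isometries, they also define a metric on the vertical vectors, independent of the
section.

A metric on `M` then needs only a smooth complement to the vertical spaces that every symmetry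
preserves. The tensor `S` provides it. The symmetry at `a ⊗ u` fixes the whole fibre through that
point, because `a σ(a)⁻¹ σ(a) = a`, so `S` is the identity on vertical vectors. It covers the
symmetry of `G ⧸ H`, whose differential at its fixed point has no nonzero fixed vector
(`eq_zero_of_fixed`). As `S ^ k = 1`, the average `P` of `1, S, …, S ^ (k - 1)` is therefore a
projection onto the vertical space, and it is smooth because `S` is. The metric is the pull-back of
`gN` plus the fibre metric evaluated on `P v` and `P w`.

Left distributivity `x · (y · z) = (x · y) · (x · z)` shows that the differentials of the symmetries
commute with `S`, hence with `P`. A symmetry also covers an isometry of `N` and carries fibres to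
fibres by `b ⊗ u ↦ b' ⊗ u`, so it preserves both summands of the metric.

The absence of fixed vectors on `G ⧸ H` is where the hypothesis on the identity component enters.
Linearizing `σ` near `1` by averaging a chart shows that a vector fixed by `dσ` is the velocity of a
curve in that component (`exists_curve_of_fixedDeriv_eq`), so it is killed by the projection to `G ⧸
H`. Since `dσ` has finite order, a fixed vector of the quotient lifts to a fixed vector. -/

namespace SigmaManifold

open Bundle


/-! ### Smoothness of fields of linear maps and bilinear forms -/

section HomBundle

variable {B : Type*} {EB : Type*} [NormedAddCommGroup EB] [NormedSpace ℝ EB]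
  {HB : Type*} [TopologicalSpace HB] {IB : ModelWithCorners ℝ EB HB}
  [TopologicalSpace B] [ChartedSpace HB B]
  {F₁ : Type*} [NormedAddCommGroup F₁] [NormedSpace ℝ F₁]
  {E₁ : B → Type*} [∀ x, AddCommGroup (E₁ x)] [∀ x, Module ℝ (E₁ x)]
  [TopologicalSpace (TotalSpace F₁ E₁)] [∀ x, TopologicalSpace (E₁ x)]
  [∀ x, IsTopologicalAddGroup (E₁ x)] [∀ x, ContinuousSMul ℝ (E₁ x)]
  [FiberBundle F₁ E₁] [VectorBundle ℝ F₁ E₁]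
  {F₂ : Type*} [NormedAddCommGroup F₂] [NormedSpace ℝ F₂]
  {E₂ : B → Type*} [∀ x, AddCommGroup (E₂ x)] [∀ x, Module ℝ (E₂ x)]
  [TopologicalSpace (TotalSpace F₂ E₂)] [∀ x, TopologicalSpace (E₂ x)]
  [∀ x, IsTopologicalAddGroup (E₂ x)] [∀ x, ContinuousSMul ℝ (E₂ x)]
  [FiberBundle F₂ E₂] [VectorBundle ℝ F₂ E₂]

/-- A map into a space of continuous linear maps with finite-dimensional source is smooth as
soon as its evaluations are. -/
theorem contMDiffAt_clm_of_apply {n : WithTop ℕ∞} [FiniteDimensional ℝ F₁] {f : B → F₁ →L[ℝ] F₂}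
    {x₀ : B} (h : ∀ v, ContMDiffAt IB 𝓘(ℝ, F₂) n (fun x => f x v) x₀) :
    ContMDiffAt IB 𝓘(ℝ, F₁ →L[ℝ] F₂) n f x₀ := by
  let d := Module.finrank ℝ F₁
  have hd : d = Module.finrank ℝ (Fin d → ℝ) := (Module.finrank_fin_fun ℝ).symm
  let e₁ := ContinuousLinearEquiv.ofFinrankEq hd
  let e₂ := (e₁.arrowCongr (1 : F₂ ≃L[ℝ] F₂)).trans
    (ContinuousLinearEquiv.piRing (𝕜 := ℝ) (E := F₂) (Fin d))
  have key : ContMDiffAt IB 𝓘(ℝ, Fin d → F₂) n (fun x => e₂ (f x)) x₀ := by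
    rw [contMDiffAt_pi_space]
    intro i
    exact h (e₁.symm (Pi.single i 1))
  have := (e₂.symm.contDiff.contMDiff (n := n)).contMDiffAt.comp x₀ key
  refine this.congr_of_eventuallyEq (Filter.Eventually.of_forall fun x => ?_)
  simp

/-- A section of a bundle of homomorphisms is smooth as soon as it maps smooth sections to
smooth sections. -/
theorem contMDiffAt_clm_bundle_of_apply {n : WithTop ℕ∞} [FiniteDimensional ℝ F₁]
    [ContMDiffVectorBundle n F₁ E₁ IB] [ContMDiffVectorBundle n F₂ E₂ IB]
    {φ : ∀ x, E₁ x →L[ℝ] E₂ x} {x₀ : B}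
    (h : ∀ V : ∀ x, E₁ x,
      ContMDiffAt IB (IB.prod 𝓘(ℝ, F₁)) n (fun x => TotalSpace.mk' F₁ x (V x)) x₀ →
      ContMDiffAt IB (IB.prod 𝓘(ℝ, F₂)) n (fun x => TotalSpace.mk' F₂ x (φ x (V x))) x₀) :
    ContMDiffAt IB (IB.prod 𝓘(ℝ, F₁ →L[ℝ] F₂)) n
      (fun x => TotalSpace.mk' (F₁ →L[ℝ] F₂) (E := fun x => E₁ x →L[ℝ] E₂ x) x (φ x)) x₀ := by
  rw [contMDiffAt_hom_bundle]
  refine ⟨contMDiffAt_id, contMDiffAt_clm_of_apply fun v => ?_⟩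
  let e := trivializationAt F₁ E₁ x₀
  -- The test section has constant coordinate `v` in the trivialization at `x₀`; smoothness at `x₀`
  -- is all that is required of it.
  have hV : ContMDiffAt IB (IB.prod 𝓘(ℝ, F₁)) n
      (fun x => TotalSpace.mk' F₁ x (e.symmL ℝ x v)) x₀ := by
    have h1 := e.contMDiffAt_symmL (n := n) (IB := IB) (mem_baseSet_trivializationAt F₁ E₁ x₀)
    have h2 : ContMDiffAt IB (IB.prod 𝓘(ℝ, F₁)) n
      (fun x => TotalSpace.mk' F₁ (E := Bundle.Trivial B F₁) x v) x₀ := by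
      rw [contMDiffAt_totalSpace]
      exact ⟨contMDiffAt_id, contMDiffAt_const⟩
    exact h1.clm_bundle_apply h2
  have h3 := (contMDiffAt_totalSpace.1 (h _ hV)).2
  refine h3.congr_of_eventuallyEq ?_
  filter_upwards [(trivializationAt F₂ E₂ x₀).open_baseSet.mem_nhds
    (mem_baseSet_trivializationAt F₂ E₂ x₀)] with x hx
  simp [ContinuousLinearMap.inCoordinates, Bundle.Trivialization.coe_linearMapAt_of_mem _ hx, e]

/-- A field of bilinear forms is smooth as soon as it maps pairs of smooth sections to smooth
functions. -/
theorem contMDiffAt_bilinForm_of_apply {n : WithTop ℕ∞} [FiniteDimensional ℝ F₁]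
    [ContMDiffVectorBundle n F₁ E₁ IB]
    {b : ∀ x, E₁ x →L[ℝ] E₁ x →L[ℝ] ℝ} {x₀ : B}
    (h : ∀ V W : ∀ x, E₁ x,
      ContMDiffAt IB (IB.prod 𝓘(ℝ, F₁)) n (fun x => TotalSpace.mk' F₁ x (V x)) x₀ →
      ContMDiffAt IB (IB.prod 𝓘(ℝ, F₁)) n (fun x => TotalSpace.mk' F₁ x (W x)) x₀ →
      ContMDiffAt IB 𝓘(ℝ, ℝ) n (fun x => b x (V x) (W x)) x₀) :
    ContMDiffAt IB (IB.prod 𝓘(ℝ, F₁ →L[ℝ] F₁ →L[ℝ] ℝ)) n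
      (fun x => TotalSpace.mk' (F₁ →L[ℝ] F₁ →L[ℝ] ℝ)
        (E := fun x => E₁ x →L[ℝ] E₁ x →L[ℝ] ℝ) x (b x)) x₀ := by
  refine contMDiffAt_clm_bundle_of_apply fun V hV => ?_
  refine contMDiffAt_clm_bundle_of_apply (E₂ := Bundle.Trivial B ℝ) fun W hW => ?_
  rw [contMDiffAt_totalSpace]
  exact ⟨contMDiffAt_id, h V W hV hW⟩

end HomBundle

/-- The unit ball of a positive definite bilinear form on a finite-dimensional space is
bounded. -/
theorem isVonNBounded_of_pos {E : Type*} [NormedAddCommGroup E] [NormedSpace ℝ E]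
    [FiniteDimensional ℝ E] (b : E →L[ℝ] E →L[ℝ] ℝ) (hb : ∀ v, v ≠ 0 → 0 < b v v) :
    Bornology.IsVonNBounded ℝ {v : E | b v v < 1} := by
  rw [NormedSpace.isVonNBounded_iff]
  rcases subsingleton_or_nontrivial E with hE | hE
  · exact (Set.toFinite _).isBounded
  have hc : Continuous fun v => b v v := by fun_prop
  -- By homogeneity `b v v ≥ ‖v‖² b z z`, where `z` minimizes the form on the compact unit sphere;
  -- this gives the radius `√(1 / b z z)`.
  obtain ⟨z, hz, hmin⟩ := (isCompact_sphere (0 : E) 1).exists_isMinOn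
    (NormedSpace.sphere_nonempty.2 zero_le_one) hc.continuousOn
  have hz0 : z ≠ 0 := by
    rintro rfl
    simp at hz
  have hpos := hb z hz0
  rw [isBounded_iff_forall_norm_le]
  refine ⟨√(1 / b z z), fun v hv => ?_⟩
  rcases eq_or_ne v 0 with rfl | hv0
  · simp
  apply Real.le_sqrt_of_sq_le
  have hn : 0 < ‖v‖ := norm_pos_iff.2 hv0
  have h1 : b z z ≤ b (‖v‖⁻¹ • v) (‖v‖⁻¹ • v) :=
    hmin (by simp [norm_smul, hn.ne'])
  simp only [map_smul, smul_apply, smul_eq_mul] at h1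
  rw [le_div_iff₀ hpos]
  have hv' : b v v < 1 := hv
  calc ‖v‖ ^ 2 * b z z ≤ ‖v‖ ^ 2 * (‖v‖⁻¹ * (‖v‖⁻¹ * b v v)) := by gcongr
    _ = b v v := by field_simp
    _ ≤ 1 := hv'.le

/-! ### Differentials at fixed points and the tensor `S` -/

section Differential

variable {E : Type*} [NormedAddCommGroup E] [NormedSpace ℝ E]
  {H : Type*} [TopologicalSpace H] {I : ModelWithCorners ℝ E H}
  {M : Type*} [TopologicalSpace M] [ChartedSpace H M]
  {E' : Type*} [NormedAddCommGroup E'] [NormedSpace ℝ E']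
  {H' : Type*} [TopologicalSpace H'] {I' : ModelWithCorners ℝ E' H'}
  {M' : Type*} [TopologicalSpace M'] [ChartedSpace H' M']

/-- A map with a differentiable local section has surjective differentials along the section. -/
theorem mfderiv_surjective_of_section {f : M → M'} {s : M' → M} {x : M} {y : M'} (hy : s y = x)
    (hf : MDifferentiableAt I I' f x) (hs : MDifferentiableAt I' I s y)
    (hfs : ∀ z, f (s z) = z) : Function.Surjective (mfderiv I I' f x) := by
  subst hy
  intro v
  have h1 := mfderiv_comp_apply (I := I') (I' := I) (I'' := I') y hf hs
  have h2 : f ∘ s = id := funext hfs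
  have h3 : HasMFDerivAt I' I' (f ∘ s) y (ContinuousLinearMap.id ℝ (TangentSpace I' y)) := by
    rw [h2]; exact hasMFDerivAt_id y
  have h4 := hasMFDerivAt_unique (hf.hasMFDerivAt.comp y hs.hasMFDerivAt) h3
  exact ⟨mfderiv I' I s y v, DFunLike.congr_fun h4 v⟩

/-- The differential at a fixed point `x` of `f`, as an endomorphism of the tangent space. -/
noncomputable def fixedDeriv (I : ModelWithCorners ℝ E H) (f : M → M) (x : M) :
    E →L[ℝ] E :=
  mfderiv I I f x

/-- This is the chain rule along the constant orbit of `x`. Differentiability of the iterates is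
part of the induction because each step of the chain rule needs it. -/
theorem fixedDeriv_iterate {f : M → M} {x : M} (hf : MDifferentiableAt I I f x) (hx : f x = x)
    (n : ℕ) : MDifferentiableAt I I f^[n] x ∧
      ∀ v : E, fixedDeriv I f^[n] x v = (fixedDeriv I f x)^[n] v := by
  induction n with
  | zero =>
    refine ⟨mdifferentiableAt_id, fun v => ?_⟩
    change mfderiv I I id x v = v
    rw [mfderiv_id]; rfl
  | succ n ih =>
    have hfn : f^[n] x = x := Function.iterate_fixed hx n
    rw [Function.iterate_succ']
    refine ⟨MDifferentiableAt.comp_of_eq x hf ih.1 hfn, fun v => ?_⟩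
    rw [Function.iterate_succ_apply', ← ih.2]
    exact mfderiv_comp_apply_of_eq x hf ih.1 hfn v

theorem fixedDeriv_iterate_eq_self {f : M → M} {x : M} (hf : MDifferentiableAt I I f x)
    (hx : f x = x) {k : ℕ} (hk : f^[k] = id) (v : E) : (fixedDeriv I f x)^[k] v = v := by
  rw [← (fixedDeriv_iterate hf hx k).2, hk]
  change mfderiv I I id x v = v
  rw [mfderiv_id]; rfl

theorem mfderiv_prodMk_zero_apply {E'' : Type*} [NormedAddCommGroup E''] [NormedSpace ℝ E'']
    {H'' : Type*} [TopologicalSpace H''] {I'' : ModelWithCorners ℝ E'' H''}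
    {M'' : Type*} [TopologicalSpace M''] [ChartedSpace H'' M''] {f : M × M' → M''} {x : M} {y : M'}
    (hf : MDifferentiableAt (I.prod I') I'' f (x, y)) (w : E') :
    (mfderiv (I.prod I') I'' f (x, y) : E × E' → E'') (0, w) =
      mfderiv I' I'' (fun z => f (x, z)) y w := by
  have h := mfderiv_comp_apply (I := I') (I' := I.prod I') (I'' := I'') (g := f)
    (f := fun z => (x, z)) y hf (mdifferentiableAt_const.prodMk mdifferentiableAt_id) w
  rw [mfderiv_prod_right] at h
  exact h.symm

end Differential

section Symmetry

variable {E : Type*} [NormedAddCommGroup E] [NormedSpace ℝ E]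
  {M : Type*} [TopologicalSpace M] [ChartedSpace E M] [IsManifold 𝓘(ℝ, E) ∞ M]

/-- The field of differentials of a smooth multiplication is smooth. -/
theorem contMDiff_symmetryTensor {s : M → M → M}
    (hs : ContMDiff (𝓘(ℝ, E).prod 𝓘(ℝ, E)) 𝓘(ℝ, E) ∞ (fun p : M × M => s p.1 p.2)) :
    ContMDiff 𝓘(ℝ, E).tangent 𝓘(ℝ, E).tangent ∞ (symmetryTensor E s) := by
  have hT := hs.contMDiff_tangentMap (m := ∞) (by simp)
  have hz : ContMDiff 𝓘(ℝ, E).tangent 𝓘(ℝ, E).tangent ∞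
      (fun v : TangentBundle 𝓘(ℝ, E) M =>
        zeroSection E (TangentSpace 𝓘(ℝ, E) : M → Type _) v.proj) :=
    (Bundle.contMDiff_zeroSection ℝ (TangentSpace 𝓘(ℝ, E) : M → Type _)).comp
      (contMDiff_proj (TangentSpace 𝓘(ℝ, E)))
  -- `S v` is the tangent map of the multiplication at the pair `(0, v)`: the first factor is frozen
  -- at the base point of `v`.
  have h1 := hT.comp (contMDiff_equivTangentBundleProd_symm.comp (hz.prodMk contMDiff_id))
  convert! h1 using 1
  funext v
  have hd : MDifferentiableAt (𝓘(ℝ, E).prod 𝓘(ℝ, E)) 𝓘(ℝ, E) (fun p : M × M => s p.1 p.2)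
      (v.proj, v.proj) := hs.mdifferentiable (by simp) _
  exact congrArg (TotalSpace.mk _) (mfderiv_prodMk_zero_apply hd v.2).symm

omit [IsManifold 𝓘(ℝ, E) ∞ M] in
theorem tangentBundle_mk_congr {x y : M} (h : x = y) (v : E) :
    (⟨x, v⟩ : TangentBundle 𝓘(ℝ, E) M) = ⟨y, v⟩ := by
  subst h; rfl

/-- All tangent spaces are modelled on `E`, so the base point `s x x` can be replaced by `x` without
transporting the vector. -/
theorem symmetryTensor_eq {s : M → M → M} (hs : ∀ x, s x x = x) (v : TangentBundle 𝓘(ℝ, E) M) :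
    symmetryTensor E s v = ⟨v.proj, fixedDeriv 𝓘(ℝ, E) (s v.proj) v.proj v.2⟩ :=
  tangentBundle_mk_congr (hs _) _

theorem symmetryTensor_iterate {s : M → M → M} (hs : ∀ x, s x x = x) (n : ℕ) (x : M) (w : E) :
    (symmetryTensor E s)^[n] ⟨x, w⟩ = ⟨x, (fixedDeriv 𝓘(ℝ, E) (s x) x)^[n] w⟩ := by
  induction n with
  | zero => rfl
  | succ n ih =>
    rw [Function.iterate_succ_apply', ih, symmetryTensor_eq hs]
    exact congrArg (TotalSpace.mk x)
      (Function.iterate_succ_apply' (fixedDeriv 𝓘(ℝ, E) (s x) x) n w).symm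

end Symmetry


/-! ### Smooth structures from local homeomorphisms; local sections of submersions -/

section Glue

variable {E : Type*} [NormedAddCommGroup E] [NormedSpace ℝ E]
  {H : Type*} [TopologicalSpace H] {I : ModelWithCorners ℝ E H}
  {B : Type*} [TopologicalSpace B] [ChartedSpace H B]
  {M : Type*} [TopologicalSpace M] {ι : Type*}

/-- The charted space structure on `M` obtained by composing a covering family of local
homeomorphisms to `B` with the charts of `B`. -/
@[reducible] noncomputable def chartedSpaceOfLocalHomeo (e : ι → OpenPartialHomeomorph M B)
    (hcover : ∀ x, ∃ i, x ∈ (e i).source) : ChartedSpace H M where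
  atlas := {f | ∃ i, ∃ c ∈ atlas H B, f = e i ≫ₕ c}
  chartAt x := e (hcover x).choose ≫ₕ chartAt H (e (hcover x).choose x)
  mem_chart_source x := by simpa using (hcover x).choose_spec
  chart_mem_atlas x := ⟨_, _, chart_mem_atlas H _, rfl⟩

/-- The transition maps of the composite charts are those of the family `e` read in charts of `B`.
It is applied to bundle trivializations, whose values lie in a manifold and not in a model space. -/
theorem exists_isManifold_of_localHomeo [IsManifold I ∞ B] (e : ι → OpenPartialHomeomorph M B)
    (hcover : ∀ x, ∃ i, x ∈ (e i).source)
    (hcompat : ∀ i j, ContMDiffOn I I ∞ (e j ∘ (e i).symm) ((e i).symm ≫ₕ e j).source) :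
    ∃ (_ : ChartedSpace H M) (_ : IsManifold I ∞ M), ∀ i,
      ContMDiffOn I I ∞ (e i) (e i).source ∧ ContMDiffOn I I ∞ (e i).symm (e i).target := by
  let cs : ChartedSpace H M := chartedSpaceOfLocalHomeo e hcover
  have hM : IsManifold I ∞ M := by
    refine isManifold_of_contDiffOn I ∞ M ?_
    rintro _ _ ⟨i, c, hc, rfl⟩ ⟨j, c', hc', rfl⟩
    have h1 : ContMDiffOn I I ∞ ((e i ≫ₕ c).symm ≫ₕ (e j ≫ₕ c'))
        ((e i ≫ₕ c).symm ≫ₕ (e j ≫ₕ c')).source := by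
      have hs := contMDiffOn_symm_of_mem_maximalAtlas (I := I) (n := ∞)
        (IsManifold.subset_maximalAtlas hc)
      have ht := contMDiffOn_of_mem_maximalAtlas (I := I) (n := ∞)
        (IsManifold.subset_maximalAtlas hc')
      refine (ht.comp ((hcompat i j).comp (hs.mono ?_) ?_) ?_)
      · intro z hz
        simp only [mfld_simps] at hz ⊢
        tauto
      · intro z hz
        simp only [mfld_simps] at hz ⊢
        tauto
      · intro z hz
        simp only [mfld_simps] at hz ⊢
        tauto
    rw [contMDiffOn_iff] at h1
    -- Smoothness between open sets of the model space becomes ordinary smoothness once read in its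
    -- only chart; naming that chart needs a point `z`.
    rcases isEmpty_or_nonempty H with hH | ⟨⟨z⟩⟩
    · intro x hx
      exact (hH.false (I.symm x)).elim
    have h2 := h1.2 z z
    simp only [mfld_simps, chartAt_self_eq] at h2
    refine (h2.mono fun x hx => ?_).congr fun x hx => ?_
    · simp only [mfld_simps] at hx ⊢
      tauto
    · simp only [mfld_simps]
  refine ⟨cs, hM, fun i => ⟨fun x hx => ?_, fun y hy => ?_⟩⟩
  · refine ContMDiffAt.contMDiffWithinAt ?_
    set c := chartAt H (e i x)
    have h1 : e i ≫ₕ c ∈ IsManifold.maximalAtlas I ∞ M :=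
      IsManifold.subset_maximalAtlas ⟨i, c, chart_mem_atlas H _, rfl⟩
    have hx' : x ∈ (e i ≫ₕ c).source := by simp [c, hx]
    have h2 := contMDiffAt_of_mem_maximalAtlas h1 hx'
    have h3 : ContMDiffAt I I ∞ c.symm ((e i ≫ₕ c) x) :=
      contMDiffAt_symm_of_mem_maximalAtlas (IsManifold.chart_mem_maximalAtlas _)
        (by simp [c])
    refine (h3.comp x h2).congr_of_eventuallyEq ?_
    filter_upwards [(e i ≫ₕ c).open_source.mem_nhds hx'] with z hz
    simp only [mfld_simps] at hz ⊢
    simp [hz.2]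
  · refine ContMDiffAt.contMDiffWithinAt ?_
    set c := chartAt H y
    have h1 : e i ≫ₕ c ∈ IsManifold.maximalAtlas I ∞ M :=
      IsManifold.subset_maximalAtlas ⟨i, c, chart_mem_atlas H _, rfl⟩
    have hy' : c y ∈ (e i ≫ₕ c).target := by simp [c, hy]
    have h2 := contMDiffAt_symm_of_mem_maximalAtlas h1 hy'
    have h3 : ContMDiffAt I I ∞ c y :=
      contMDiffAt_of_mem_maximalAtlas (IsManifold.chart_mem_maximalAtlas _) (by simp [c])
    refine (h2.comp y h3).congr_of_eventuallyEq ?_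
    filter_upwards [c.open_source.mem_nhds (mem_chart_source H y)] with z hz
    simp only [mfld_simps] at hz ⊢
    simp [hz]

end Glue

/-- Every submersion has a smooth local section through every point. -/
theorem exists_localSection_of_isSubmersionAt
    {E : Type*} [NormedAddCommGroup E] [NormedSpace ℝ E]
    {H : Type*} [TopologicalSpace H] {I : ModelWithCorners ℝ E H}
    {M : Type*} [TopologicalSpace M] [ChartedSpace H M] [IsManifold I ∞ M]
    {E' : Type*} [NormedAddCommGroup E'] [NormedSpace ℝ E']
    {H' : Type*} [TopologicalSpace H'] {I' : ModelWithCorners ℝ E' H'}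
    {M' : Type*} [TopologicalSpace M'] [ChartedSpace H' M'] [IsManifold I' ∞ M']
    [I.Boundaryless]
    {f : M → M'} {x : M} (hf : Manifold.IsSubmersionAt I I' ∞ f x) :
    ∃ (s : M' → M) (U : Set M'), IsOpen U ∧ f x ∈ U ∧ ContMDiffOn I' I ∞ s U ∧ s (f x) = x ∧
      ∀ y ∈ U, f (s y) = y := by
  let α := hf.domChart
  let β := hf.codChart
  let L := hf.equiv
  have hα : x ∈ α.source := hf.mem_domChart_source
  have hβ : f x ∈ β.source := hf.mem_codChart_source
  have hαm : α ∈ IsManifold.maximalAtlas I ∞ M := hf.domChart_mem_maximalAtlas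
  have hβm : β ∈ IsManifold.maximalAtlas I' ∞ M' := hf.codChart_mem_maximalAtlas
  have hw := hf.writtenInCharts
  -- In suitable charts `f` is a product projection. The section keeps the complementary coordinate
  -- equal to that of `x`, so that it passes through `x`.
  let j : E' → E := fun w => L.symm (w, (L (α.extend I x)).2)
  have hj : ContDiff ℝ ∞ j := by fun_prop
  have hxt : α.extend I x ∈ (α.extend I).target := (α.extend I).map_source (by simpa using hα)
  have hjx : j (β.extend I' (f x)) = α.extend I x := by
    have := hw hxt
    have hx' : (α.extend I).symm (α.extend I x) = x := α.extend_left_inv hα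
    simp only [Function.comp] at this
    rw [hx'] at this
    simp only [j]
    rw [L.symm_apply_eq]
    exact Prod.ext this rfl
  let s : M' → M := fun y => (α.extend I).symm (j (β.extend I' y))
  have hto : IsOpen (α.extend I).target := α.isOpen_extend_target
  have hβs : ContMDiffOn I' 𝓘(ℝ, E') ∞ (β.extend I') β.source := fun y hy =>
    (β.contMDiffAt_extend hβm hy).contMDiffWithinAt
  have hαs : ContMDiffOn 𝓘(ℝ, E) I ∞ (α.extend I).symm (α.extend I).target := by
    have := contMDiffOn_extend_symm hαm
    rwa [α.extend_target']
  have hjβ : ContMDiffOn I' 𝓘(ℝ, E) ∞ (fun y => j (β.extend I' y)) β.source :=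
    hj.contMDiff.comp_contMDiffOn hβs
  let U := β.source ∩ (fun y => j (β.extend I' y)) ⁻¹' (α.extend I).target
  refine ⟨s, U, hjβ.continuousOn.isOpen_inter_preimage β.open_source hto, ⟨hβ, ?_⟩, ?_, ?_, ?_⟩
  · change j (β.extend I' (f x)) ∈ (α.extend I).target
    rw [hjx]; exact hxt
  · exact hαs.comp (hjβ.mono Set.inter_subset_left) fun y hy => hy.2
  · change (α.extend I).symm (j (β.extend I' (f x))) = x
    rw [hjx]; exact α.extend_left_inv hα
  · rintro y ⟨hy1, hy2⟩
    have h1 := hw hy2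
    have h2 : s y ∈ α.source := by
      have := (α.extend I).map_target hy2
      rwa [α.extend_source] at this
    have h3 : f (s y) ∈ β.source := hf.source_subset_preimage_source h2
    have h4 : β.extend I' (f (s y)) = β.extend I' y := by
      refine h1.trans ?_
      simp [j, L]
    have h5 := congrArg (β.extend I').symm h4
    rwa [β.extend_left_inv h3, β.extend_left_inv hy1] at h5


/-! ### Set-theoretic trivializations of `G ×_H Λ` -/

section Algebra

variable {G : Type*} [Group G] {H : Subgroup G} {Λ : Type*} [MulAction H Λ]

/-- The `H`-component `s(bH)⁻¹ b` of `b : G` with respect to a section `s` of `G → G ⧸ H`. -/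
def fiberCoord (s : G ⧸ H → G) (hs : ∀ y, QuotientGroup.mk (s y) = y) (b : G) : H :=
  ⟨(s (QuotientGroup.mk b))⁻¹ * b, by rw [← QuotientGroup.eq, hs]⟩

variable {s : G ⧸ H → G} (hs : ∀ y, QuotientGroup.mk (s y) = y)

theorem fiberCoord_mul (b : G) (h : H) : fiberCoord s hs (b * h) = fiberCoord s hs b * h := by
  ext
  simp [fiberCoord, mul_assoc]

theorem mul_fiberCoord (b : G) : s (QuotientGroup.mk b) * fiberCoord s hs b = b := by
  simp [fiberCoord]

theorem fiberCoord_section (y : G ⧸ H) : fiberCoord s hs (s y) = 1 := by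
  ext
  simp [fiberCoord, hs]

variable (Λ) in
/-- The trivialization of `G ×_H Λ` defined by a section of `G → G ⧸ H`. -/
def assocTriv : AssocBundle H Λ ≃ (G ⧸ H) × Λ where
  toFun x := (assocProj H Λ x, Quotient.lift (fun p : G × Λ => fiberCoord s hs p.1 • p.2) (by
    rintro p q ⟨h, h1, h2⟩
    simp [h1, h2, fiberCoord_mul, mul_smul]) x)
  invFun p := tmul H (s p.1) p.2
  left_inv := by
    rintro ⟨b, u⟩
    change tmul H (s (QuotientGroup.mk b)) (fiberCoord s hs b • u) = tmul H b u
    rw [← tmul_mul, mul_fiberCoord]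
  right_inv := by
    rintro ⟨y, u⟩
    change ((s y : G ⧸ H), fiberCoord s hs (s y) • u) = (y, u)
    rw [hs, fiberCoord_section, one_smul]

theorem assocTriv_tmul (b : G) (u : Λ) :
    assocTriv Λ hs (tmul H b u) = (QuotientGroup.mk b, fiberCoord s hs b • u) :=
  rfl

theorem assocTriv_symm_apply (p : (G ⧸ H) × Λ) : (assocTriv Λ hs).symm p = tmul H (s p.1) p.2 :=
  rfl

theorem tmul_assocTriv (x : AssocBundle H Λ) :
    tmul H (s (assocProj H Λ x)) (assocTriv Λ hs x).2 = x :=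
  (assocTriv Λ hs).symm_apply_apply x

theorem exists_tmul (x : AssocBundle H Λ) : ∃ a u, tmul H a u = x := by
  obtain ⟨⟨a, u⟩, rfl⟩ := Quotient.exists_rep x
  exact ⟨a, u, rfl⟩

end Algebra

/-! ### The quotient topology -/

section Topology

variable {G : Type*} [Group G] [TopologicalSpace G] {H : Subgroup G}
  {Λ : Type*} [TopologicalSpace Λ] [MulAction H Λ]

theorem continuous_tmul : Continuous fun p : G × Λ => tmul H p.1 p.2 :=
  continuous_quotient_mk'

theorem isOpenQuotientMap_tmul [IsTopologicalGroup G] [ContinuousSMul H Λ] :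
    IsOpenQuotientMap fun p : G × Λ => tmul H p.1 p.2 where
  surjective := fun x => (exists_tmul x).elim fun a ⟨u, h⟩ => ⟨(a, u), h⟩
  continuous := continuous_tmul
  isOpenMap := by
    intro U hU
    -- The saturation of `U` is the union of its translates under `H`, each of which is open.
    have h1 : (fun p : G × Λ => tmul H p.1 p.2) ⁻¹' ((fun p : G × Λ => tmul H p.1 p.2) '' U) =
        ⋃ h : H, (fun p : G × Λ => (p.1 * (h : G)⁻¹, h • p.2)) ⁻¹' U := by
      ext ⟨a, u⟩
      simp only [Set.mem_preimage, Set.mem_image, Set.mem_iUnion, Prod.exists]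
      constructor
      · rintro ⟨b, v, hbv, hq⟩
        obtain ⟨h, h1, h2⟩ := Quotient.exact hq
        simp only at h1 h2
        refine ⟨h⁻¹, ?_⟩
        simpa [h1, h2] using hbv
      · rintro ⟨h, hh⟩
        refine ⟨_, _, hh, ?_⟩
        rw [← tmul_mul]
        simp
    refine isOpen_coinduced.2 ?_
    refine h1 ▸ isOpen_iUnion fun h => hU.preimage ?_
    fun_prop

theorem continuous_assocProj : Continuous (assocProj H Λ) :=
  Continuous.quotient_lift (QuotientGroup.continuous_mk.comp continuous_fst) _

theorem secondCountableTopology_assocBundle [IsTopologicalGroup G] [ContinuousSMul H Λ]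
    [SecondCountableTopology G] [SecondCountableTopology Λ] :
    SecondCountableTopology (AssocBundle H Λ) :=
  isOpenQuotientMap_tmul.isQuotientMap.secondCountableTopology isOpenQuotientMap_tmul.isOpenMap

theorem t2Space_assocBundle [IsTopologicalGroup G] [ContinuousSMul H Λ] [T2Space Λ]
    (hH : IsClosed (H : Set G)) : T2Space (AssocBundle H Λ) := by
  rw [t2Space_iff_of_isOpenQuotientMap (isOpenQuotientMap_tmul (H := H) (Λ := Λ))]
  -- The Hausdorff property amounts to the relation being closed. The pairs `(a, u)`, `(b, v)` with
  -- `b⁻¹ a ∈ H` form a closed set, on which the relation is the closed condition `v = (b⁻¹ a) • u`.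
  let C : Set ((G × Λ) × (G × Λ)) := {p | p.2.1⁻¹ * p.1.1 ∈ H}
  have hC : IsClosed C := hH.preimage (f := fun p : (G × Λ) × (G × Λ) => p.2.1⁻¹ * p.1.1)
    (by fun_prop)
  let h : C → H := fun p => ⟨p.1.2.1⁻¹ * p.1.1.1, p.2⟩
  have hh : Continuous h := Continuous.subtype_mk (by fun_prop) _
  have hD : IsClosed {p : C | p.1.2.2 = h p • p.1.1.2} :=
    isClosed_eq (by fun_prop) (hh.smul (by fun_prop))
  convert! hC.isClosedEmbedding_subtypeVal.isClosedMap _ hD using 1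
  ext ⟨⟨a, u⟩, ⟨b, v⟩⟩
  simp only [Set.mem_ofPred_eq, Set.mem_image, Subtype.exists]
  constructor
  · intro hq
    obtain ⟨k, h1, h2⟩ := Quotient.exact hq
    simp only at h1 h2
    have hk : b⁻¹ * a = k := by rw [h1]; group
    refine ⟨_, show b⁻¹ * a ∈ H by rw [hk]; exact k.2, ?_, rfl⟩
    simp only [h, hk]
    exact h2
  · rintro ⟨p, hp, hp', rfl⟩
    exact Quotient.sound ⟨⟨b⁻¹ * a, hp⟩, by simp, hp'⟩

end Topology

/-! ### Smooth local sections and the manifold structure -/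

section Smooth

variable {EG : Type*} [NormedAddCommGroup EG] [NormedSpace ℝ EG]
  {G : Type*} [Group G] [TopologicalSpace G] [ChartedSpace EG G]
  {H : Subgroup G}
  {EH : Type*} [NormedAddCommGroup EH] [NormedSpace ℝ EH]
  [ChartedSpace EH H]
  {EN : Type*} [NormedAddCommGroup EN] [NormedSpace ℝ EN]
  [ChartedSpace EN (G ⧸ H)]
  {EΛ : Type*} [NormedAddCommGroup EΛ] [NormedSpace ℝ EΛ]
  {Λ : Type*} [TopologicalSpace Λ] [ChartedSpace EΛ Λ] [MulAction H Λ]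

/-- `s` is a section of `G → G ⧸ H` which is smooth on the open set `U`. -/
structure IsSmoothSection (EG EN : Type*) [NormedAddCommGroup EG] [NormedSpace ℝ EG]
    [NormedAddCommGroup EN] [NormedSpace ℝ EN]
    {G : Type*} [Group G] [TopologicalSpace G] [ChartedSpace EG G] {H : Subgroup G}
    [ChartedSpace EN (G ⧸ H)] (s : G ⧸ H → G) (U : Set (G ⧸ H)) : Prop where
  mk_apply : ∀ y, QuotientGroup.mk (s y) = y
  isOpen : IsOpen U
  contMDiffOn : ContMDiffOn 𝓘(ℝ, EN) 𝓘(ℝ, EG) ∞ s U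

theorem exists_isSmoothSection [IsManifold 𝓘(ℝ, EG) ∞ G] [IsManifold 𝓘(ℝ, EN) ∞ (G ⧸ H)]
    (hN : Manifold.IsSubmersion 𝓘(ℝ, EG) 𝓘(ℝ, EN) ∞ (QuotientGroup.mk : G → G ⧸ H)) (a : G) :
    ∃ s U, IsSmoothSection EG EN (H := H) s U ∧ QuotientGroup.mk a ∈ U ∧
      s (QuotientGroup.mk a) = a := by
  classical
  obtain ⟨s, U, hU, haU, hs, hsa, hsU⟩ := exists_localSection_of_isSubmersionAt
    (hN.isSubmersionAt a)
  -- Arbitrary representatives outside `U` make the section identity hold everywhere, so that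
  -- `assocTriv` is a bijection of the whole bundle; smoothness is asked only on `U`.
  refine ⟨fun y => if y ∈ U then s y else Quotient.out y, U, ⟨fun y => ?_, hU, ?_⟩, haU, ?_⟩
  · by_cases hy : y ∈ U
    · simp only [hy, if_true]
      exact hsU y hy
    · simp only [hy, if_false]
      exact Quotient.out_eq y
  · exact hs.congr fun y hy => if_pos hy
  · simp [haU, hsa]

/-- As a map into `G`, the coordinate `s(bH)⁻¹ b` is a product of smooth maps. It is smooth into `H`
because `H` is embedded: the embedding gives continuity and the immersion then gives smoothness. -/
theorem contMDiffOn_fiberCoord [LieGroup 𝓘(ℝ, EG) ∞ G]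
    [IsManifold 𝓘(ℝ, EN) ∞ (G ⧸ H)] [IsManifold 𝓘(ℝ, EH) ∞ H]
    (hHemb : Manifold.IsSmoothEmbedding 𝓘(ℝ, EH) 𝓘(ℝ, EG) ∞ (Subtype.val : H → G))
    (hN : ContMDiff 𝓘(ℝ, EG) 𝓘(ℝ, EN) ∞ (QuotientGroup.mk : G → G ⧸ H))
    {s : G ⧸ H → G} {U : Set (G ⧸ H)} (hs : IsSmoothSection EG EN s U) :
    ContMDiffOn 𝓘(ℝ, EG) 𝓘(ℝ, EH) ∞ (fiberCoord s hs.mk_apply)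
      ((QuotientGroup.mk : G → G ⧸ H) ⁻¹' U) := by
  intro b hb
  have h1 : ContMDiffAt 𝓘(ℝ, EG) 𝓘(ℝ, EG) ∞
      (Subtype.val ∘ fiberCoord s hs.mk_apply) b :=
    (((hs.contMDiffOn.contMDiffAt (hs.isOpen.mem_nhds hb)).comp b hN.contMDiffAt).inv).mul
      contMDiffAt_id
  refine ContMDiffAt.contMDiffWithinAt ?_
  rw [ContMDiffAt.iff_comp_isImmersionAt (hHemb.isImmersion.isImmersionAt _)]
  exact ⟨hHemb.isEmbedding.continuousAt_iff.2 h1.continuousAt, h1⟩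

/-- The trivialization defined by a smooth local section, as a local homeomorphism. -/
noncomputable def assocLocalTriv [LieGroup 𝓘(ℝ, EG) ∞ G]
    [IsManifold 𝓘(ℝ, EN) ∞ (G ⧸ H)] [IsManifold 𝓘(ℝ, EH) ∞ H]
    (hHemb : Manifold.IsSmoothEmbedding 𝓘(ℝ, EH) 𝓘(ℝ, EG) ∞ (Subtype.val : H → G))
    (hN : ContMDiff 𝓘(ℝ, EG) 𝓘(ℝ, EN) ∞ (QuotientGroup.mk : G → G ⧸ H))
    (hact : ContMDiff (𝓘(ℝ, EH).prod 𝓘(ℝ, EΛ)) 𝓘(ℝ, EΛ) ∞ (fun p : H × Λ => p.1 • p.2))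
    {s : G ⧸ H → G} {U : Set (G ⧸ H)} (hs : IsSmoothSection EG EN s U) :
    OpenPartialHomeomorph (AssocBundle H Λ) ((G ⧸ H) × Λ) where
  toFun := assocTriv Λ hs.mk_apply
  invFun := (assocTriv Λ hs.mk_apply).symm
  source := assocProj H Λ ⁻¹' U
  target := U ×ˢ Set.univ
  map_source' x hx := ⟨hx, trivial⟩
  map_target' p hp := by
    rw [assocTriv_symm_apply, Set.mem_preimage, assocProj_tmul, hs.mk_apply]
    exact hp.1
  left_inv' x _ := (assocTriv Λ hs.mk_apply).symm_apply_apply x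
  right_inv' p _ := (assocTriv Λ hs.mk_apply).apply_symm_apply p
  open_source := hs.isOpen.preimage continuous_assocProj
  open_target := hs.isOpen.prod isOpen_univ
  continuousOn_toFun := by
    have := topologicalGroup_of_lieGroup 𝓘(ℝ, EG) ∞ (G := G)
    have : ContinuousSMul H Λ := ⟨hact.continuous⟩
    rw [isOpenQuotientMap_tmul.isQuotientMap.continuousOn_isOpen_iff
      (hs.isOpen.preimage continuous_assocProj)]
    refine ContinuousOn.prodMk (QuotientGroup.continuous_mk.comp continuous_fst).continuousOn ?_
    exact ((contMDiffOn_fiberCoord hHemb hN hs).continuousOn.comp continuousOn_fst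
      fun p hp => hp).smul continuousOn_snd
  continuousOn_invFun :=
    continuous_tmul.comp_continuousOn ((hs.contMDiffOn.continuousOn.comp continuousOn_fst
      fun p hp => hp.1).prodMk continuousOn_snd)

/-- The smooth structure of the associated bundle `G ×_H Λ`: the quotient map and the projection
are smooth, and so are the local trivializations defined by local sections. -/
theorem exists_isManifold_assocBundle [LieGroup 𝓘(ℝ, EG) ∞ G]
    [IsManifold 𝓘(ℝ, EN) ∞ (G ⧸ H)] [IsManifold 𝓘(ℝ, EH) ∞ H] [IsManifold 𝓘(ℝ, EΛ) ∞ Λ]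
    (hHemb : Manifold.IsSmoothEmbedding 𝓘(ℝ, EH) 𝓘(ℝ, EG) ∞ (Subtype.val : H → G))
    (hN : Manifold.IsSubmersion 𝓘(ℝ, EG) 𝓘(ℝ, EN) ∞ (QuotientGroup.mk : G → G ⧸ H))
    (hact : ContMDiff (𝓘(ℝ, EH).prod 𝓘(ℝ, EΛ)) 𝓘(ℝ, EΛ) ∞ (fun p : H × Λ => p.1 • p.2)) :
    ∃ (_ : ChartedSpace (EN × EΛ) (AssocBundle H Λ))
      (_ : IsManifold 𝓘(ℝ, EN × EΛ) ∞ (AssocBundle H Λ)),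
      ContMDiff (𝓘(ℝ, EG).prod 𝓘(ℝ, EΛ)) 𝓘(ℝ, EN × EΛ) ∞ (fun p : G × Λ => tmul H p.1 p.2) ∧
      ContMDiff 𝓘(ℝ, EN × EΛ) 𝓘(ℝ, EN) ∞ (assocProj H Λ) ∧
      ∀ (s : G ⧸ H → G) (U : Set (G ⧸ H)) (hs : IsSmoothSection EG EN s U),
        ContMDiffOn 𝓘(ℝ, EN × EΛ) 𝓘(ℝ, EΛ) ∞ (fun x => (assocTriv Λ hs.mk_apply x).2)
          (assocProj H Λ ⁻¹' U) := by
  rw [modelWithCornersSelf_prod]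
  let ι := {p : (G ⧸ H → G) × Set (G ⧸ H) // IsSmoothSection EG EN p.1 p.2}
  let e : ι → OpenPartialHomeomorph (AssocBundle H Λ) ((G ⧸ H) × Λ) := fun i =>
    assocLocalTriv hHemb hN.contMDiff hact i.2
  have hcover : ∀ x, ∃ i, x ∈ (e i).source := by
    intro x
    obtain ⟨a, u, rfl⟩ := exists_tmul x
    obtain ⟨s, U, hs, haU, -⟩ := exists_isSmoothSection hN a
    exact ⟨⟨(s, U), hs⟩, haU⟩
  have hcompat : ∀ i j, ContMDiffOn (𝓘(ℝ, EN).prod 𝓘(ℝ, EΛ)) (𝓘(ℝ, EN).prod 𝓘(ℝ, EΛ)) ∞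
      (e j ∘ (e i).symm) ((e i).symm ≫ₕ e j).source := by
    rintro ⟨⟨s, U⟩, hs⟩ ⟨⟨s', U'⟩, hs'⟩
    simp only at hs hs'
    have hmaps : ∀ p ∈ ((e ⟨⟨s, U⟩, hs⟩).symm ≫ₕ e ⟨⟨s', U'⟩, hs'⟩).source,
        p.1 ∈ U ∧ p.1 ∈ U' := by
      rintro p ⟨hp1, hp2⟩
      refine ⟨hp1.1, ?_⟩
      have : assocProj H Λ (tmul H (s p.1) p.2) ∈ U' := hp2
      rwa [assocProj_tmul, hs.mk_apply] at this
    have h1 : ContMDiffOn (𝓘(ℝ, EN).prod 𝓘(ℝ, EΛ)) 𝓘(ℝ, EH) ∞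
        (fun p : (G ⧸ H) × Λ => fiberCoord s' hs'.mk_apply (s p.1))
        ((e ⟨⟨s, U⟩, hs⟩).symm ≫ₕ e ⟨⟨s', U'⟩, hs'⟩).source := by
      refine (contMDiffOn_fiberCoord hHemb hN.contMDiff hs').comp
        (hs.contMDiffOn.comp contMDiffOn_fst fun p hp => (hmaps p hp).1) fun p hp => ?_
      simp only [Set.mem_preimage, hs.mk_apply]
      exact (hmaps p hp).2
    -- The change of trivialization is `(y, u) ↦ (y, s'(y)⁻¹ s(y) • u)`.
    refine (contMDiffOn_fst.prodMk (hact.comp_contMDiffOn (h1.prodMk contMDiffOn_snd))).congr ?_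
    rintro ⟨y, u⟩ hp
    change (((s y : G) : G ⧸ H), fiberCoord s' hs'.mk_apply (s y) • u) = _
    rw [hs.mk_apply]
    rfl
  obtain ⟨cs, hM, he⟩ := exists_isManifold_of_localHomeo (I := 𝓘(ℝ, EN).prod 𝓘(ℝ, EΛ)) e
    hcover hcompat
  let cs' : ChartedSpace (EN × EΛ) (AssocBundle H Λ) := cs
  refine ⟨cs', hM, ?_, ?_, ?_⟩
  · rintro ⟨a, u⟩
    obtain ⟨s, U, hs, haU, -⟩ := exists_isSmoothSection hN a
    have hW : IsOpen (Prod.fst ⁻¹' ((QuotientGroup.mk : G → G ⧸ H) ⁻¹' U) : Set (G × Λ)) :=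
      (hs.isOpen.preimage QuotientGroup.continuous_mk).preimage continuous_fst
    have h1 : ContMDiffOn (𝓘(ℝ, EG).prod 𝓘(ℝ, EΛ)) (𝓘(ℝ, EN).prod 𝓘(ℝ, EΛ)) ∞
        (fun p : G × Λ => ((p.1 : G ⧸ H), fiberCoord s hs.mk_apply p.1 • p.2))
        (Prod.fst ⁻¹' ((QuotientGroup.mk : G → G ⧸ H) ⁻¹' U)) :=
      (hN.contMDiff.comp contMDiff_fst).contMDiffOn.prodMk (hact.comp_contMDiffOn
        (((contMDiffOn_fiberCoord hHemb hN.contMDiff hs).comp contMDiffOn_fst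
          fun p hp => hp).prodMk contMDiffOn_snd))
    have h2 := (he ⟨⟨s, U⟩, hs⟩).2.comp h1 fun p hp => ⟨hp, trivial⟩
    refine ((h2.contMDiffAt (hW.mem_nhds haU)).congr_of_eventuallyEq
      (Filter.Eventually.of_forall fun p => ?_))
    exact ((assocTriv Λ hs.mk_apply).symm_apply_apply (tmul H p.1 p.2)).symm
  · intro x
    obtain ⟨i, hi⟩ := hcover x
    exact (contMDiff_fst.comp_contMDiffOn (he i).1).contMDiffAt ((e i).open_source.mem_nhds hi)
  · intro s U hs
    exact contMDiff_snd.comp_contMDiffOn (he ⟨⟨s, U⟩, hs⟩).1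

end Smooth


/-! ### Fixed points of maps of finite order -/

section FixedPoints

variable {E : Type*} [NormedAddCommGroup E] [NormedSpace ℝ E] [CompleteSpace E]
  {M : Type*} [TopologicalSpace M] [ChartedSpace E M] [IsManifold 𝓘(ℝ, E) ∞ M]

/-- A tangent vector fixed by the differential of a smooth map `f` of finite order at a fixed
point is the velocity of a curve in the connected component of the set of fixed points. -/
theorem exists_curve_of_fixedDeriv_eq {f : M → M} (hf : ContMDiff 𝓘(ℝ, E) 𝓘(ℝ, E) ∞ f) {x₀ : M}
    (hx : f x₀ = x₀) {k : ℕ} (hk : 0 < k) (hfk : f^[k] = id) {v : E}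
    (hv : fixedDeriv 𝓘(ℝ, E) f x₀ v = v) :
    ∃ γ : ℝ → M, γ 0 = x₀ ∧ MDifferentiableAt 𝓘(ℝ, ℝ) 𝓘(ℝ, E) γ 0 ∧
      (mfderiv 𝓘(ℝ, ℝ) 𝓘(ℝ, E) γ 0 : ℝ → E) 1 = v ∧
      ∀ᶠ t in nhds 0, γ t ∈ connectedComponentIn {x | f x = x} x₀ := by
  let L : E →L[ℝ] E := fixedDeriv 𝓘(ℝ, E) f x₀
  let c := extChartAt 𝓘(ℝ, E) x₀
  have hfd : MDifferentiableAt 𝓘(ℝ, E) 𝓘(ℝ, E) f x₀ := hf.mdifferentiable (by simp) x₀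
  have hLk : L ^ k = 1 := by
    ext w
    rw [FunLike.coe_pow_eq_iterate]
    exact fixedDeriv_iterate_eq_self hfd hx hfk w
  have hfj : ∀ j : ℕ, ContMDiff 𝓘(ℝ, E) 𝓘(ℝ, E) ∞ f^[j] := fun j => by
    induction j with
    | zero => exact contMDiff_id
    | succ j ih => rw [Function.iterate_succ']; exact hf.comp ih
  have hxj : ∀ j : ℕ, f^[j] x₀ = x₀ := fun j => Function.iterate_fixed hx j
  -- Averaging the chart over the cyclic group generated by `f` (up to the factor `k`) linearizes
  -- `f`; `L ^ (k - j)` stands for `L⁻ʲ`. The relation `φ ∘ f = L ∘ φ` is formal, so it holds even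
  -- where `c` takes values outside its domain.
  let φ : M → E := fun x => ∑ j ∈ Finset.range k, (L ^ (k - j)) (c (f^[j] x))
  have hφf : ∀ x, φ (f x) = L (φ x) := by
    intro x
    let A : ℕ → E := fun j => (L ^ (k + 1 - j)) (c (f^[j] x))
    have h1 : φ (f x) = ∑ j ∈ Finset.range k, A (j + 1) := by
      refine Finset.sum_congr rfl fun j _ => ?_
      simp only [A, Function.iterate_succ_apply]
      congr 2
      omega
    have h2 : L (φ x) = ∑ j ∈ Finset.range k, A j := by
      rw [map_sum]
      refine Finset.sum_congr rfl fun j hj => ?_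
      have : k + 1 - j = (k - j) + 1 := by
        have := Finset.mem_range.1 hj
        omega
      simp only [A, this, pow_succ']
      rfl
    have h3 : A k = A 0 := by
      have h4 : f^[k] x = x := by rw [hfk]; rfl
      change (L ^ (k + 1 - k)) (c (f^[k] x)) = (L ^ (k + 1)) (c x)
      rw [h4, Nat.add_sub_cancel_left, pow_one, pow_succ', hLk, mul_one]
    have h5 := Finset.sum_range_succ A k
    have h6 := Finset.sum_range_succ' A k
    rw [h1, h2]
    rw [h5, h3] at h6
    exact (add_right_cancel h6).symm
  let Φ : E → E := φ ∘ c.symm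
  let p₀ := φ x₀
  have hLp : L p₀ = p₀ := by rw [← hφf, hx]
  have hcx : c.symm (c x₀) = x₀ := extChartAt_to_inv x₀
  have hterm : ∀ j, HasFDerivAt (fun z => c (f^[j] (c.symm z))) (L ^ j) (c x₀) := by
    intro j
    have h1 := (((hfj j).mdifferentiable (by simp)) x₀).hasMFDerivAt.2
    have h2 : writtenInExtChartAt 𝓘(ℝ, E) 𝓘(ℝ, E) x₀ f^[j] = fun z => c (f^[j] (c.symm z)) := by
      simp only [writtenInExtChartAt, hxj j]
      rfl
    have h3 : (mfderiv 𝓘(ℝ, E) 𝓘(ℝ, E) f^[j] x₀ : E →L[ℝ] E) = L ^ j := by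
      refine ContinuousLinearMap.ext fun w => ?_
      have := (fixedDeriv_iterate hfd hx j).2 w
      rwa [← FunLike.coe_pow_eq_iterate] at this
    rw [h2] at h1
    simp only [modelWithCornersSelf_coe, Set.range_id] at h1
    exact h3 ▸ (hasFDerivWithinAt_univ (E := E) (F := E)).1 h1
  have hk0 : (k : ℝ) ≠ 0 := by exact_mod_cast hk.ne'
  -- Each of the `k` terms has derivative `L ^ (k - j) L ^ j = 1`, so the derivative of `φ` in the
  -- chart is multiplication by `k`.
  let D : E ≃L[ℝ] E := ContinuousLinearEquiv.smulLeft (Units.mk0 (k : ℝ) hk0)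
  have hΦd : HasFDerivAt Φ (D : E →L[ℝ] E) (c x₀) := by
    have h1 : HasFDerivAt (fun z => ∑ j ∈ Finset.range k, (L ^ (k - j)) (c (f^[j] (c.symm z))))
        (∑ j ∈ Finset.range k, (L ^ (k - j)).comp (L ^ j)) (c x₀) :=
      HasFDerivAt.fun_sum fun j _ => (L ^ (k - j)).hasFDerivAt.comp _ (hterm j)
    have h2 : (∑ j ∈ Finset.range k, (L ^ (k - j)).comp (L ^ j)) = (D : E →L[ℝ] E) := by
      have h3 : ∀ j ∈ Finset.range k, (L ^ (k - j)).comp (L ^ j) = 1 := by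
        intro j hj
        have h4 : (L ^ (k - j)).comp (L ^ j) = L ^ (k - j) * L ^ j := rfl
        rw [h4, ← pow_add, Nat.sub_add_cancel (Finset.mem_range.1 hj).le, hLk]
      rw [Finset.sum_congr rfl h3]
      ext w
      simp [D, Units.smul_def, Nat.cast_smul_eq_nsmul]
    exact h2 ▸ h1
  have hΦc : ContDiffAt ℝ ∞ Φ (c x₀) := by
    have h1 : ContMDiffAt 𝓘(ℝ, E) 𝓘(ℝ, E) ∞ c.symm (c x₀) :=
      (contMDiffOn_extChartAt_symm x₀).contMDiffAt (extChartAt_target_mem_nhds x₀)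
    refine ContDiffAt.sum fun j _ => ?_
    refine (L ^ (k - j)).contDiff.contDiffAt.comp _ ?_
    rw [← contMDiffAt_iff_contDiffAt]
    have h2 : ContMDiffAt 𝓘(ℝ, E) 𝓘(ℝ, E) ∞ c (f^[j] (c.symm (c x₀))) := by
      rw [hcx, hxj]; exact contMDiffAt_extChartAt
    exact h2.comp (c x₀) (((hfj j) _).comp (c x₀) h1)
  let ψ := hΦc.toOpenPartialHomeomorph Φ hΦd (by simp)
  have hψ : ∀ z, ψ z = Φ z := fun z => rfl
  have hψs : c x₀ ∈ ψ.source := hΦc.mem_toOpenPartialHomeomorph_source hΦd (by simp)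
  have hΦ0 : Φ (c x₀) = p₀ := by simp only [Φ, Function.comp, hcx, p₀]
  have hp₀ : p₀ ∈ ψ.target := hΦ0 ▸ ψ.map_source hψs
  have hψp : ψ.symm p₀ = c x₀ := by rw [← hΦ0, ← hψ, ψ.left_inv hψs]
  have hψd : HasFDerivAt ψ.symm (D.symm : E →L[ℝ] E) p₀ := by
    refine ψ.hasFDerivAt_symm hp₀ ?_
    rw [hψp]
    exact hΦd
  -- A line of fixed points of `L`; the factor `k` compensates the derivative of the inverse of `φ`,
  -- so that the lifted curve has velocity `v`.
  let l : ℝ → E := fun t => p₀ + t • ((k : ℝ) • v)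
  have hl0 : l 0 = p₀ := by simp [l]
  have hl : HasDerivAt l ((k : ℝ) • v) 0 := by
    have := ((hasDerivAt_id (0 : ℝ)).smul_const ((k : ℝ) • v)).const_add p₀
    rwa [one_smul] at this
  have hlc : Continuous l := by fun_prop
  have hLl : ∀ t, L (l t) = l t := by
    intro t
    simp only [l, map_add, map_smul, hLp]
    rw [show L v = v from hv]
  let γ : ℝ → M := fun t => c.symm (ψ.symm (l t))
  have hγ0 : γ 0 = x₀ := by simp only [γ, hl0, hψp, hcx]
  have hev1 : ∀ᶠ t in nhds (0 : ℝ), l t ∈ ψ.target :=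
    hlc.continuousAt.eventually_mem (ψ.open_target.mem_nhds (by rwa [hl0]))
  have hct : c.target ∈ nhds (c x₀) := extChartAt_target_mem_nhds x₀
  have hψl : ContinuousAt (fun t => ψ.symm (l t)) 0 := by
    refine ContinuousAt.comp_of_eq (y := p₀) ?_ hlc.continuousAt hl0
    exact hψd.continuousAt
  have hψl0 : ψ.symm (l 0) = c x₀ := by rw [hl0, hψp]
  have hev2 : ∀ᶠ t in nhds (0 : ℝ), ψ.symm (l t) ∈ c.target :=
    hψl.eventually_mem (by rwa [hψl0])
  have hγc : ContinuousAt γ 0 := by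
    refine ContinuousAt.comp_of_eq (y := c x₀) ?_ hψl hψl0
    exact continuousAt_extChartAt_symm x₀
  have hev3 : ∀ᶠ t in nhds (0 : ℝ), f (γ t) ∈ c.source := by
    refine (hf.continuous.continuousAt.comp hγc).eventually_mem ?_
    rw [Function.comp_apply, hγ0, hx]
    exact extChartAt_source_mem_nhds x₀
  have hev4 : ∀ᶠ t in nhds (0 : ℝ), c (f (γ t)) ∈ ψ.source := by
    have h1 : ContinuousAt (fun t => c (f (γ t))) 0 := by
      refine ContinuousAt.comp_of_eq (y := x₀) ?_ (hf.continuous.continuousAt.comp hγc) ?_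
      · exact continuousAt_extChartAt x₀
      · simp only [hγ0, hx]
    refine h1.eventually_mem ?_
    simp only [hγ0, hx]
    exact ψ.open_source.mem_nhds hψs
  have hcγ : ∀ᶠ t in nhds (0 : ℝ), c (γ t) = ψ.symm (l t) :=
    hev2.mono fun t ht => c.right_inv ht
  have hγd : HasMFDerivAt 𝓘(ℝ, ℝ) 𝓘(ℝ, E) γ 0 (ContinuousLinearMap.toSpanSingleton ℝ v) := by
    refine ⟨hγc, ?_⟩
    have h1 : writtenInExtChartAt 𝓘(ℝ, ℝ) 𝓘(ℝ, E) 0 γ = fun t => c (γ t) := by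
      simp only [writtenInExtChartAt, hγ0]
      rfl
    rw [h1]
    simp only [modelWithCornersSelf_coe, Set.range_id]
    refine (hasFDerivWithinAt_univ (E := ℝ) (F := E)).2 ?_
    have h2 : HasDerivAt (fun t => ψ.symm (l t)) (D.symm ((k : ℝ) • v)) 0 :=
      HasFDerivAt.comp_hasDerivAt_of_eq 0 hψd hl hl0.symm
    have h3 : D.symm ((k : ℝ) • v) = v := by
      rw [D.symm_apply_eq]
      simp [D, Units.smul_def]
    rw [h3] at h2
    exact (h2.congr_of_eventuallyEq hcγ).hasFDerivAt
  refine ⟨γ, hγ0, hγd.mdifferentiableAt, ?_, ?_⟩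
  · rw [hγd.mfderiv]
    exact one_smul ℝ v
  obtain ⟨ε, hε, hball⟩ := Metric.eventually_nhds_iff_ball.1
    (hev1.and (hev2.and (hev3.and hev4)))
  have hγball : ContinuousOn γ (Metric.ball 0 ε) := by
    refine (continuousOn_extChartAt_symm x₀).comp
      (ψ.symm.continuousOn.comp hlc.continuousOn fun t ht => (hball t ht).1)
      fun t ht => (hball t ht).2.1
  -- `f (γ t)` and `γ t` have the same image `l t` under `φ`, which is injective near `x₀`.
  have hfix : ∀ t ∈ Metric.ball (0 : ℝ) ε, f (γ t) = γ t := by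
    intro t ht
    obtain ⟨h1, h2, h3, h4⟩ := hball t ht
    have h5 : c (γ t) = ψ.symm (l t) := c.right_inv h2
    have h6 : φ (γ t) = l t := ψ.right_inv h1
    have h7 : φ (f (γ t)) = l t := by rw [hφf, h6, hLl]
    have h8 : ψ (c (f (γ t))) = l t := by
      rw [hψ]
      simp only [Φ, Function.comp, c.left_inv h3, h7]
    have h9 : c (f (γ t)) = ψ.symm (l t) := by rw [← h8, ψ.left_inv h4]
    rw [← c.left_inv h3, h9]
  have h0 : (0 : ℝ) ∈ Metric.ball (0 : ℝ) ε := Metric.mem_ball_self hε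
  filter_upwards [Metric.ball_mem_nhds (0 : ℝ) hε] with t ht
  have hpre : IsPreconnected (γ '' Metric.ball 0 ε) :=
    (convex_ball (0 : ℝ) ε).isPreconnected.image _ hγball
  refine hpre.subset_connectedComponentIn ⟨0, h0, hγ0⟩ ?_ ⟨t, ht, rfl⟩
  rintro _ ⟨r, hr, rfl⟩
  exact hfix r hr

end FixedPoints


/-! ### The symmetries of `G ⧸ H` have no nonzero fixed tangent vectors -/

section Group

variable {EG : Type*} [NormedAddCommGroup EG] [NormedSpace ℝ EG]
  {G : Type*} [Group G] [TopologicalSpace G] [ChartedSpace EG G] [LieGroup 𝓘(ℝ, EG) ∞ G]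
  {σ : G ≃* G} {H : Subgroup G}
  {EN : Type*} [NormedAddCommGroup EN] [NormedSpace ℝ EN]
  [ChartedSpace EN (G ⧸ H)]

/-- Vectors fixed by the differential of `σ` are tangent to `H`. -/
theorem mfderiv_mk_eq_zero_of_fixed [CompleteSpace EG]
    (hσ : ContMDiff 𝓘(ℝ, EG) 𝓘(ℝ, EG) ∞ σ) {k : ℕ} (hk : 0 < k)
    (hσk : ∀ a : G, σ^[k] a = a)
    (hHcomp : connectedComponentIn {a : G | σ a = a} 1 ⊆ (H : Set G))
    (hN : ContMDiff 𝓘(ℝ, EG) 𝓘(ℝ, EN) ∞ (QuotientGroup.mk : G → G ⧸ H))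
    {v : EG} (hv : fixedDeriv 𝓘(ℝ, EG) σ 1 v = v) :
    (mfderiv 𝓘(ℝ, EG) 𝓘(ℝ, EN) (QuotientGroup.mk : G → G ⧸ H) 1 : EG → EN) v = 0 := by
  obtain ⟨γ, hγ0, hγd, hγv, hev⟩ := exists_curve_of_fixedDeriv_eq (f := σ) hσ (map_one σ) hk
    (funext hσk) hv
  -- The curve with velocity `v` stays in `H` near `0`, so its projection is locally constant.
  have h1 : (QuotientGroup.mk : G → G ⧸ H) ∘ γ =ᶠ[nhds 0]
      fun _ => (QuotientGroup.mk (1 : G) : G ⧸ H) := by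
    filter_upwards [hev] with t ht
    refine (QuotientGroup.eq.2 ?_).symm
    simpa using hHcomp ht
  have h2 := mfderiv_comp_apply_of_eq 0 (hN.mdifferentiable (by simp) (1 : G)) hγd hγ0 (1 : ℝ)
  rw [h1.mfderiv_eq, mfderiv_const] at h2
  rw [← hγv]
  exact h2.symm

/-- Vectors tangent to `H` are fixed by the differential of `σ`. -/
theorem fixedDeriv_eq_of_mfderiv_mk_eq_zero [IsManifold 𝓘(ℝ, EN) ∞ (G ⧸ H)]
    (hσ : ContMDiff 𝓘(ℝ, EG) 𝓘(ℝ, EG) ∞ σ) (hHfix : ∀ h ∈ H, σ h = h)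
    (hN : Manifold.IsSubmersion 𝓘(ℝ, EG) 𝓘(ℝ, EN) ∞ (QuotientGroup.mk : G → G ⧸ H))
    {v : EG}
    (hv : (mfderiv 𝓘(ℝ, EG) 𝓘(ℝ, EN) (QuotientGroup.mk : G → G ⧸ H) 1 : EG → EN) v = 0) :
    fixedDeriv 𝓘(ℝ, EG) σ 1 v = v := by
  obtain ⟨s, U, hs, h1U, hs1⟩ := exists_isSmoothSection (EN := EN) hN 1
  -- Write `b = A b · θ b` with `θ` valued in `H`. As `A` factors through `G ⧸ H`, its differential
  -- kills `v`, and the product rule leaves `dθ v = v`. Differentiating `σ ∘ θ = θ` then gives the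
  -- claim.
  let A : G → G := fun b => s (QuotientGroup.mk b)
  let θ : G → G := fun b => fiberCoord s hs.mk_apply b
  have hsd : MDifferentiableAt 𝓘(ℝ, EN) 𝓘(ℝ, EG) s (QuotientGroup.mk (1 : G)) :=
    (hs.contMDiffOn.contMDiffAt (hs.isOpen.mem_nhds h1U)).mdifferentiableAt (by simp)
  have hmk : MDifferentiableAt 𝓘(ℝ, EG) 𝓘(ℝ, EN) (QuotientGroup.mk : G → G ⧸ H) 1 :=
    hN.contMDiff.mdifferentiable (by simp) 1
  have hAc : ContMDiffAt 𝓘(ℝ, EG) 𝓘(ℝ, EG) ∞ A 1 :=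
    (hs.contMDiffOn.contMDiffAt (hs.isOpen.mem_nhds h1U)).comp 1 hN.contMDiff.contMDiffAt
  have hθc : ContMDiffAt 𝓘(ℝ, EG) 𝓘(ℝ, EG) ∞ θ 1 := hAc.inv.mul contMDiffAt_id
  have hA : MDifferentiableAt 𝓘(ℝ, EG) 𝓘(ℝ, EG) A 1 := hAc.mdifferentiableAt (by simp)
  have hθ : MDifferentiableAt 𝓘(ℝ, EG) 𝓘(ℝ, EG) θ 1 := hθc.mdifferentiableAt (by simp)
  have hA1 : A 1 = 1 := hs1
  have hθ1 : θ 1 = 1 := by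
    have := mul_fiberCoord hs.mk_apply (1 : G)
    rwa [hs1, one_mul] at this
  have hAv : (mfderiv 𝓘(ℝ, EG) 𝓘(ℝ, EG) A 1 : EG → EG) v = 0 := by
    have h1 := mfderiv_comp_apply 1 hsd hmk v
    have h2 : (mfderiv 𝓘(ℝ, EN) 𝓘(ℝ, EG) s (QuotientGroup.mk (1 : G)) : EN → EG)
        ((mfderiv 𝓘(ℝ, EG) 𝓘(ℝ, EN) (QuotientGroup.mk : G → G ⧸ H) 1 : EG → EN) v) = 0 := by
      rw [hv]
      exact map_zero _
    exact h1.trans h2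
  have hm : MDifferentiableAt (𝓘(ℝ, EG).prod 𝓘(ℝ, EG)) 𝓘(ℝ, EG)
      (fun p : G × G => p.1 * p.2) (1, 1) :=
    (contMDiff_mul 𝓘(ℝ, EG) ∞).mdifferentiable (by simp) _
  have hθv : (mfderiv 𝓘(ℝ, EG) 𝓘(ℝ, EG) θ 1 : EG → EG) v = v := by
    have h1 := mfderiv_comp_apply_of_eq (y := ((1 : G), (1 : G))) 1 hm (hA.prodMk hθ)
      (Prod.ext hA1 hθ1) v
    have h2 : (fun p : G × G => p.1 * p.2) ∘ (fun b => (A b, θ b)) = id :=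
      funext fun b => mul_fiberCoord hs.mk_apply b
    have h3 : (mfderiv 𝓘(ℝ, EG) (𝓘(ℝ, EG).prod 𝓘(ℝ, EG)) (fun b => (A b, θ b)) 1 :
        EG → EG × EG) v = (0, (mfderiv 𝓘(ℝ, EG) 𝓘(ℝ, EG) θ 1 : EG → EG) v) := by
      rw [mfderiv_prodMk hA hθ]
      exact Prod.ext hAv rfl
    have h4 := mfderiv_prodMk_zero_apply hm ((mfderiv 𝓘(ℝ, EG) 𝓘(ℝ, EG) θ 1 : EG → EG) v)
    have h5 : (fun z : G => (1 : G) * z) = id := funext fun z => one_mul z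
    simp only at h4
    rw [h5, mfderiv_id] at h4
    rw [h2, mfderiv_id] at h1
    refine h4.symm.trans (Eq.trans ?_ h1.symm)
    exact congrArg (mfderiv (𝓘(ℝ, EG).prod 𝓘(ℝ, EG)) 𝓘(ℝ, EG)
      (fun p : G × G => p.1 * p.2) (1, 1)) h3.symm
  have h1 := mfderiv_comp_apply_of_eq 1 (hσ.mdifferentiable (by simp) (1 : G)) hθ hθ1 v
  have h2 : σ ∘ θ = θ := funext fun b => hHfix _ (fiberCoord s hs.mk_apply b).2
  rw [h2] at h1
  change (mfderiv 𝓘(ℝ, EG) 𝓘(ℝ, EG) θ 1 : EG → EG) v = fixedDeriv 𝓘(ℝ, EG) σ 1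
    ((mfderiv 𝓘(ℝ, EG) 𝓘(ℝ, EG) θ 1 : EG → EG) v) at h1
  rw [hθv] at h1
  exact h1.symm

/-- An operator of finite order has no generalized eigenvectors for the eigenvalue `1`. -/
theorem eq_of_unipotent_of_iterate_eq {E : Type*} [AddCommGroup E] [Module ℝ E] {L : E → E}
    (hL : ∀ x y, L (x + y) = L x + L y) {k : ℕ} (hk : 0 < k) {x : E} (hx : L^[k] x = x)
    (h : L (L x - x) = L x - x) : L x = x := by
  -- At `n = k` this linear growth contradicts periodicity unless `L x = x`.
  have h1 : ∀ n : ℕ, L^[n] x = x + n • (L x - x) := by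
    intro n
    induction n with
    | zero => simp
    | succ n ih =>
      have h2 : ∀ m : ℕ, L (m • (L x - x)) = m • (L x - x) := by
        intro m
        have h0 : L 0 = 0 := by simpa using hL 0 0
        induction m with
        | zero => simpa using h0
        | succ m ihm => rw [succ_nsmul, hL, ihm, h]
      rw [Function.iterate_succ_apply', ih, hL, h2, succ_nsmul]
      abel
  have h3 := h1 k
  rw [hx, left_eq_add, ← Nat.cast_smul_eq_nsmul ℝ, smul_eq_zero, sub_eq_zero] at h3
  rcases h3 with h3 | h3
  · exact absurd h3 (by exact_mod_cast hk.ne')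
  · exact h3

omit [TopologicalSpace G] in
theorem cosetMul_self (hHfix : ∀ h ∈ H, σ h = h) (y : G ⧸ H) : cosetMul σ H hHfix y y = y := by
  obtain ⟨a, rfl⟩ := QuotientGroup.mk_surjective y
  rw [cosetMul_mk]
  simp

/-- The differential of the symmetry of `G ⧸ H` at the base point has no nonzero fixed
vector. -/
theorem eq_zero_of_fixed_base [CompleteSpace EG] [IsManifold 𝓘(ℝ, EN) ∞ (G ⧸ H)]
    (hσ : ContMDiff 𝓘(ℝ, EG) 𝓘(ℝ, EG) ∞ σ) {k : ℕ} (hk : 0 < k)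
    (hσk : ∀ a : G, σ^[k] a = a) (hHfix : ∀ h ∈ H, σ h = h)
    (hHcomp : connectedComponentIn {a : G | σ a = a} 1 ⊆ (H : Set G))
    (hN : Manifold.IsSubmersion 𝓘(ℝ, EG) 𝓘(ℝ, EN) ∞ (QuotientGroup.mk : G → G ⧸ H))
    (hsN : ∀ y : G ⧸ H, ContMDiff 𝓘(ℝ, EN) 𝓘(ℝ, EN) ∞ (cosetMul σ H hHfix y)) {z : EN}
    (hz : fixedDeriv 𝓘(ℝ, EN) (cosetMul σ H hHfix (QuotientGroup.mk 1))
      (QuotientGroup.mk 1 : G ⧸ H) z = z) : z = 0 := by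
  have hmk : MDifferentiableAt 𝓘(ℝ, EG) 𝓘(ℝ, EN) (QuotientGroup.mk : G → G ⧸ H) 1 :=
    hN.contMDiff.mdifferentiable (by simp) 1
  let D : EG →L[ℝ] EN := mfderiv 𝓘(ℝ, EG) 𝓘(ℝ, EN) (QuotientGroup.mk : G → G ⧸ H) 1
  let L : EG →L[ℝ] EG := fixedDeriv 𝓘(ℝ, EG) σ 1
  have hσd := hσ.mdifferentiable (by simp) (1 : G)
  have hD : ∀ v, D (L v) = fixedDeriv 𝓘(ℝ, EN) (cosetMul σ H hHfix (QuotientGroup.mk 1))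
      (QuotientGroup.mk 1 : G ⧸ H) (D v) := by
    intro v
    have h1 := mfderiv_comp_apply_of_eq 1 hmk hσd (map_one σ) v
    have h2 := mfderiv_comp_apply 1
      ((hsN (QuotientGroup.mk 1)).mdifferentiable (by simp) (QuotientGroup.mk (1 : G))) hmk v
    have h3 : (QuotientGroup.mk : G → G ⧸ H) ∘ σ =
        cosetMul σ H hHfix (QuotientGroup.mk 1) ∘ (QuotientGroup.mk : G → G ⧸ H) := by
      funext b
      simp [cosetMul_mk]
    rw [h3] at h1
    exact h1.symm.trans h2
  obtain ⟨s, U, hs, h1U, hs1⟩ := exists_isSmoothSection (EN := EN) hN 1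
  obtain ⟨X, hX⟩ : ∃ X : EG, D X = z := mfderiv_surjective_of_section (f := (QuotientGroup.mk : G → G ⧸ H)) hs1 hmk
    ((hs.contMDiffOn.contMDiffAt (hs.isOpen.mem_nhds h1U)).mdifferentiableAt (by simp))
    hs.mk_apply z
  -- A lift `X` of a fixed vector is fixed modulo the kernel of `D`, on which `L` is the identity.
  -- Thus `L` is unipotent on the span of `X` and `L X`, and its finite order forces `L X = X`.
  have h1 : D (L X - X) = 0 := by rw [map_sub, hD, hX, hz, sub_self]
  have h2 : L (L X - X) = L X - X := fixedDeriv_eq_of_mfderiv_mk_eq_zero hσ hHfix hN h1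
  have h3 : L X = X := eq_of_unipotent_of_iterate_eq (map_add L) hk
    (fixedDeriv_iterate_eq_self hσd (map_one σ) (funext hσk) X) h2
  rw [← hX]
  exact mfderiv_mk_eq_zero_of_fixed hσ hk hσk hHcomp hN.contMDiff h3

/-- The differential of the symmetry of `G ⧸ H` at any point has no nonzero fixed vector. -/
theorem eq_zero_of_fixed [CompleteSpace EG] [IsManifold 𝓘(ℝ, EN) ∞ (G ⧸ H)]
    (hσ : ContMDiff 𝓘(ℝ, EG) 𝓘(ℝ, EG) ∞ σ) {k : ℕ} (hk : 0 < k)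
    (hσk : ∀ a : G, σ^[k] a = a) (hHfix : ∀ h ∈ H, σ h = h)
    (hHcomp : connectedComponentIn {a : G | σ a = a} 1 ⊆ (H : Set G))
    (hN : Manifold.IsSubmersion 𝓘(ℝ, EG) 𝓘(ℝ, EN) ∞ (QuotientGroup.mk : G → G ⧸ H))
    (hsN : ∀ y : G ⧸ H, ContMDiff 𝓘(ℝ, EN) 𝓘(ℝ, EN) ∞ (cosetMul σ H hHfix y))
    (hgN : ∀ a : G, ContMDiff 𝓘(ℝ, EN) 𝓘(ℝ, EN) ∞ (fun y : G ⧸ H => a • y))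
    (y : G ⧸ H) {z : EN} (hz : fixedDeriv 𝓘(ℝ, EN) (cosetMul σ H hHfix y) y z = z) : z = 0 := by
  obtain ⟨a, rfl⟩ := QuotientGroup.mk_surjective y
  let o : G ⧸ H := QuotientGroup.mk 1
  let τ : G ⧸ H → G ⧸ H := fun y => a⁻¹ • y
  let τ' : G ⧸ H → G ⧸ H := fun y => a • y
  have hτo : τ (QuotientGroup.mk a) = o := by
    change QuotientGroup.mk (a⁻¹ * a) = o
    rw [inv_mul_cancel]
  have hτ := (hgN a⁻¹).mdifferentiable (by simp) (QuotientGroup.mk a)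
  have hτ' := (hgN a).mdifferentiable (by simp) o
  have hs := (hsN (QuotientGroup.mk a)).mdifferentiable (by simp) (QuotientGroup.mk a)
  have hs1 := (hsN o).mdifferentiable (by simp) o
  -- Translation by `a⁻¹` conjugates the symmetry at `aH` to the one at the base point.
  have hcomm : cosetMul σ H hHfix o ∘ τ = τ ∘ cosetMul σ H hHfix (QuotientGroup.mk a) := by
    funext y
    obtain ⟨b, rfl⟩ := QuotientGroup.mk_surjective y
    change QuotientGroup.mk (1 * (σ 1)⁻¹ * σ (a⁻¹ * b)) =
      QuotientGroup.mk (a⁻¹ * (a * (σ a)⁻¹ * σ b))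
    simp [mul_assoc]
  let w : EN := mfderiv 𝓘(ℝ, EN) 𝓘(ℝ, EN) τ (QuotientGroup.mk a) z
  have hw : w = 0 := by
    refine eq_zero_of_fixed_base hσ hk hσk hHfix hHcomp hN hsN ?_
    have h1 := mfderiv_comp_apply_of_eq _ hs1 hτ hτo z
    have h2 := mfderiv_comp_apply_of_eq _ hτ hs (cosetMul_self hHfix _) z
    rw [hcomm] at h1
    have h3 := h1.symm.trans h2
    change fixedDeriv 𝓘(ℝ, EN) (cosetMul σ H hHfix o) o w =
      (mfderiv 𝓘(ℝ, EN) 𝓘(ℝ, EN) τ (QuotientGroup.mk a) : EN → EN)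
        (fixedDeriv 𝓘(ℝ, EN) (cosetMul σ H hHfix (QuotientGroup.mk a)) (QuotientGroup.mk a) z)
      at h3
    rw [hz] at h3
    exact h3
  have h1 := mfderiv_comp_apply_of_eq _ hτ' hτ hτo z
  have h2 : τ' ∘ τ = id := funext fun y => smul_inv_smul a y
  change (mfderiv 𝓘(ℝ, EN) 𝓘(ℝ, EN) (τ' ∘ τ) (QuotientGroup.mk a) : EN → EN) z =
    (mfderiv 𝓘(ℝ, EN) 𝓘(ℝ, EN) τ' o : EN → EN) w at h1
  rw [h2, mfderiv_id, hw] at h1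
  exact h1.trans (map_zero (mfderiv 𝓘(ℝ, EN) 𝓘(ℝ, EN) τ' o))

end Group


/-! ### Differentials and metrics read in the model spaces -/

section Derivative

variable {E : Type*} [NormedAddCommGroup E] [NormedSpace ℝ E]
  {M : Type*} [TopologicalSpace M] [ChartedSpace E M]
  {E' : Type*} [NormedAddCommGroup E'] [NormedSpace ℝ E']
  {M' : Type*} [TopologicalSpace M'] [ChartedSpace E' M']
  {E'' : Type*} [NormedAddCommGroup E''] [NormedSpace ℝ E'']
  {M'' : Type*} [TopologicalSpace M''] [ChartedSpace E'' M'']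

/-- The differential of `f` at `x`, as a linear map between the model spaces. -/
noncomputable def tderiv (E E' : Type*) [NormedAddCommGroup E] [NormedSpace ℝ E]
    [NormedAddCommGroup E'] [NormedSpace ℝ E'] {M : Type*} [TopologicalSpace M]
    [ChartedSpace E M] {M' : Type*} [TopologicalSpace M'] [ChartedSpace E' M'] (f : M → M')
    (x : M) : E →L[ℝ] E' :=
  mfderiv 𝓘(ℝ, E) 𝓘(ℝ, E') f x

theorem tderiv_comp {g : M' → M''} {f : M → M'} {x : M} {y : M'}
    (hg : MDifferentiableAt 𝓘(ℝ, E') 𝓘(ℝ, E'') g y) (hf : MDifferentiableAt 𝓘(ℝ, E) 𝓘(ℝ, E') f x)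
    (hy : f x = y) (v : E) :
    tderiv E E'' (g ∘ f) x v = tderiv E' E'' g y (tderiv E E' f x v) :=
  mfderiv_comp_apply_of_eq x hg hf hy v

theorem tderiv_id (x : M) (v : E) : tderiv E E id x v = v := by
  change mfderiv 𝓘(ℝ, E) 𝓘(ℝ, E) id x v = v
  rw [mfderiv_id]; rfl

theorem tderiv_const (y : M') (x : M) (v : E) : tderiv E E' (fun _ : M => y) x v = 0 := by
  change mfderiv 𝓘(ℝ, E) 𝓘(ℝ, E') (fun _ : M => y) x v = 0
  rw [mfderiv_const]; rfl

theorem tderiv_eq_of_comp_eq {E₁ : Type*} [NormedAddCommGroup E₁] [NormedSpace ℝ E₁]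
    {M₁ : Type*} [TopologicalSpace M₁] [ChartedSpace E₁ M₁]
    {f : M → M'} {f' : M → M₁} {g : M' → M''} {g' : M₁ → M''} {x : M} {y : M'} {y' : M₁}
    (hg : MDifferentiableAt 𝓘(ℝ, E') 𝓘(ℝ, E'') g y) (hf : MDifferentiableAt 𝓘(ℝ, E) 𝓘(ℝ, E') f x)
    (hy : f x = y) (hg' : MDifferentiableAt 𝓘(ℝ, E₁) 𝓘(ℝ, E'') g' y')
    (hf' : MDifferentiableAt 𝓘(ℝ, E) 𝓘(ℝ, E₁) f' x) (hy' : f' x = y') (h : g ∘ f = g' ∘ f')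
    (v : E) :
    tderiv E' E'' g y (tderiv E E' f x v) = tderiv E₁ E'' g' y' (tderiv E E₁ f' x v) := by
  rw [← tderiv_comp hg hf hy, h, tderiv_comp hg' hf' hy']

/-- The chain rule for `z ↦ F (f z, g z)` in a direction annihilated by the differential
of `f`. -/
theorem tderiv_comp_prodMk {M₀ : Type*} {E₀ : Type*} [NormedAddCommGroup E₀] [NormedSpace ℝ E₀]
    [TopologicalSpace M₀] [ChartedSpace E₀ M₀] {F : M' × M'' → M₀} {f : M → M'} {g : M → M''}
    {x : M} {v : E}
    (hF : MDifferentiableAt (𝓘(ℝ, E').prod 𝓘(ℝ, E'')) 𝓘(ℝ, E₀) F (f x, g x))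
    (hf : MDifferentiableAt 𝓘(ℝ, E) 𝓘(ℝ, E') f x) (hg : MDifferentiableAt 𝓘(ℝ, E) 𝓘(ℝ, E'') g x)
    (hv : tderiv E E' f x v = 0) :
    tderiv E E₀ (fun z => F (f z, g z)) x v =
      tderiv E'' E₀ (fun w => F (f x, w)) (g x) (tderiv E E'' g x v) := by
  have h1 := mfderiv_comp_apply x hF (hf.prodMk hg) v
  have h3 : (mfderiv 𝓘(ℝ, E) (𝓘(ℝ, E').prod 𝓘(ℝ, E'')) (fun z => (f z, g z)) x :
      E → E' × E'') v = (0, tderiv E E'' g x v) := by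
    rw [mfderiv_prodMk hf hg]
    exact Prod.ext hv rfl
  have h4 := mfderiv_prodMk_zero_apply hF (tderiv E E'' g x v)
  refine h1.trans (Eq.trans ?_ h4)
  exact congrArg (mfderiv (𝓘(ℝ, E').prod 𝓘(ℝ, E'')) 𝓘(ℝ, E₀) F (f x, g x)) h3

variable [IsManifold 𝓘(ℝ, E) ∞ M] [IsManifold 𝓘(ℝ, E') ∞ M']

/-- The inner product of a metric, as a bilinear form on the model space. -/
noncomputable def Metric.form (g : Metric E M) (x : M) : E →L[ℝ] E →L[ℝ] ℝ :=
  g.inner x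

theorem Metric.form_self_eq_zero (g : Metric E M) {x : M} {v : E} (h : g.form x v v = 0) :
    v = 0 := by
  by_contra hv
  exact (g.pos x v hv).ne' h

theorem Metric.form_self_nonneg (g : Metric E M) (x : M) (v : E) : 0 ≤ g.form x v v := by
  rcases eq_or_ne v 0 with rfl | hv
  · simp
  · exact (g.pos x v hv).le

/-- The inner product of the images of smooth vector fields under the differential of a smooth
map is smooth. -/
theorem contMDiffAt_form_tderiv (g : Metric E' M') {f : M → M'} {U : Set M} (hU : IsOpen U)
    (hf : ContMDiffOn 𝓘(ℝ, E) 𝓘(ℝ, E') ∞ f U) {x₀ : M} (hx₀ : x₀ ∈ U) {V W : M → E}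
    (hV : ContMDiffAt 𝓘(ℝ, E) 𝓘(ℝ, E).tangent ∞
      (fun x => (⟨x, V x⟩ : TangentBundle 𝓘(ℝ, E) M)) x₀)
    (hW : ContMDiffAt 𝓘(ℝ, E) 𝓘(ℝ, E).tangent ∞
      (fun x => (⟨x, W x⟩ : TangentBundle 𝓘(ℝ, E) M)) x₀) :
    ContMDiffAt 𝓘(ℝ, E) 𝓘(ℝ, ℝ) ∞
      (fun x => g.form (f x) (tderiv E E' f x (V x)) (tderiv E E' f x (W x))) x₀ := by
  have hT : ContMDiffOn 𝓘(ℝ, E).tangent 𝓘(ℝ, E').tangent ∞ (tangentMap 𝓘(ℝ, E) 𝓘(ℝ, E') f)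
      (TotalSpace.proj ⁻¹' U) := by
    refine (hf.contMDiffOn_tangentMapWithin (m := ∞) (by simp) hU.uniqueMDiffOn).congr ?_
    intro v hv
    simp only [tangentMap, tangentMapWithin, mfderivWithin_of_isOpen hU hv]
  have hUo : IsOpen (TotalSpace.proj ⁻¹' U : Set (TangentBundle 𝓘(ℝ, E) M)) :=
    hU.preimage (FiberBundle.continuous_proj E _)
  have key : ∀ {V : M → E}, ContMDiffAt 𝓘(ℝ, E) 𝓘(ℝ, E).tangent ∞
      (fun x => (⟨x, V x⟩ : TangentBundle 𝓘(ℝ, E) M)) x₀ →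
      ContMDiffAt 𝓘(ℝ, E) 𝓘(ℝ, E').tangent ∞
      (fun x => (⟨f x, tderiv E E' f x (V x)⟩ : TangentBundle 𝓘(ℝ, E') M')) x₀ := fun {V} hV =>
    ContMDiffAt.comp (g := tangentMap 𝓘(ℝ, E) 𝓘(ℝ, E') f) x₀
      (hT.contMDiffAt (hUo.mem_nhds hx₀)) hV
  have hfx : ContMDiffAt 𝓘(ℝ, E) 𝓘(ℝ, E') ∞ f x₀ := hf.contMDiffAt (hU.mem_nhds hx₀)
  have h1 := (g.contMDiff.contMDiffAt (x := f x₀)).comp x₀ hfx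
  have h2 := ContMDiffAt.clm_bundle_apply₂ (E₃ := Bundle.Trivial M' ℝ) (F₃ := ℝ)
    (ψ := fun x => g.inner (f x)) (b := f) h1 (key hV) (key hW)
  exact (contMDiffAt_totalSpace.1 h2).2

end Derivative

/-! ### Averages of operators of finite order -/

section Average

variable {E : Type*} [NormedAddCommGroup E] [NormedSpace ℝ E]
  {E' : Type*} [NormedAddCommGroup E'] [NormedSpace ℝ E']

/-- The average of the first `k` powers of an endomorphism. -/
noncomputable def average (k : ℕ) (L : E →L[ℝ] E) : E →L[ℝ] E :=
  (k : ℝ)⁻¹ • ∑ j ∈ Finset.range k, L ^ j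

theorem average_apply (k : ℕ) (L : E →L[ℝ] E) (v : E) :
    average k L v = (k : ℝ)⁻¹ • ∑ j ∈ Finset.range k, (L ^ j) v := by
  simp [average]

/-- Applying `L` permutes the terms of the sum cyclically. -/
theorem map_average {k : ℕ} {L : E →L[ℝ] E} {v : E} (h : (L ^ k) v = v) :
    L (average k L v) = average k L v := by
  rw [average_apply, map_smul, map_sum]
  congr 1
  have h1 := Finset.sum_range_succ (fun j => (L ^ j) v) k
  have h2 := Finset.sum_range_succ' (fun j => (L ^ j) v) k
  rw [h1, h, pow_zero] at h2
  refine (add_right_cancel h2 |>.trans ?_).symm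
  refine Finset.sum_congr rfl fun j _ => ?_
  rw [pow_succ']
  rfl

theorem average_eq_self {k : ℕ} (hk : 0 < k) {L : E →L[ℝ] E} {v : E} (h : L v = v) :
    average k L v = v := by
  have h1 : ∀ j : ℕ, (L ^ j) v = v := fun j => by
    rw [FunLike.coe_pow_eq_iterate]
    exact Function.iterate_fixed h j
  have hk0 : (k : ℝ) ≠ 0 := by exact_mod_cast hk.ne'
  rw [average_apply, Finset.sum_congr rfl fun j _ => h1 j, Finset.sum_const, Finset.card_range,
    ← Nat.cast_smul_eq_nsmul ℝ, inv_smul_smul₀ hk0]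

theorem map_average_of_comm (k : ℕ) {L : E →L[ℝ] E} {L' : E' →L[ℝ] E'} {T : E →L[ℝ] E'}
    (h : ∀ v, T (L v) = L' (T v)) (v : E) : T (average k L v) = average k L' (T v) := by
  have h1 : ∀ (j : ℕ) (v : E), T ((L ^ j) v) = (L' ^ j) (T v) := fun j => by
    induction j with
    | zero => intro v; rfl
    | succ j ih =>
      intro v
      rw [pow_succ, pow_succ]
      change T ((L ^ j) (L v)) = (L' ^ j) (L' (T v))
      rw [ih, h]
  rw [average_apply, average_apply, map_smul, map_sum]
  simp only [h1]

end Average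

/-! ### Algebraic identities of the multiplication -/

section Multiplication

variable {G : Type*} [Group G] {σ : G ≃* G} {H : Subgroup G} (hHfix : ∀ h ∈ H, σ h = h)
  {Λ : Type*} [MulAction H Λ]

theorem assocMul_self (x : AssocBundle H Λ) : assocMul σ H hHfix Λ x x = x := by
  obtain ⟨a, u, rfl⟩ := exists_tmul x
  rw [assocMul_tmul]
  simp

theorem assocMul_comp_tmul (a b : G) (u : Λ) :
    assocMul σ H hHfix Λ (tmul H a u) ∘ tmul H b = tmul H (a * (σ a)⁻¹ * σ b) :=
  rfl

/-- Differentiated at `y`, this left distributivity becomes the invariance of `S` under the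
symmetries. -/
theorem assocMul_distrib (x y : AssocBundle H Λ) :
    assocMul σ H hHfix Λ x ∘ assocMul σ H hHfix Λ y =
      assocMul σ H hHfix Λ (assocMul σ H hHfix Λ x y) ∘ assocMul σ H hHfix Λ x := by
  funext z
  obtain ⟨a, u, rfl⟩ := exists_tmul x
  obtain ⟨b, v, rfl⟩ := exists_tmul y
  obtain ⟨c, w, rfl⟩ := exists_tmul z
  simp only [Function.comp, assocMul_tmul]
  congr 1
  simp only [map_mul, map_inv]
  group

/-- On the `G`-component the symmetry at `a ⊗ u` is `σ` conjugated by left translation by `a`, so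
its powers are the conjugates of the powers of `σ`. -/
theorem assocMul_iterate_tmul (a b : G) (u v : Λ) (n : ℕ) :
    (assocMul σ H hHfix Λ (tmul H a u))^[n] (tmul H b v) = tmul H (a * σ^[n] (a⁻¹ * b)) v := by
  induction n with
  | zero => simp
  | succ n ih =>
    rw [Function.iterate_succ_apply', ih, assocMul_tmul, Function.iterate_succ_apply', map_mul]
    congr 1
    group

theorem assocMul_iterate {k : ℕ} (hσk : ∀ a : G, σ^[k] a = a) (x : AssocBundle H Λ) :
    (assocMul σ H hHfix Λ x)^[k] = id := by
  funext z
  obtain ⟨a, u, rfl⟩ := exists_tmul x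
  obtain ⟨b, v, rfl⟩ := exists_tmul z
  rw [assocMul_iterate_tmul, hσk, mul_inv_cancel_left]
  rfl

theorem assocProj_comp_assocMul (x : AssocBundle H Λ) :
    assocProj H Λ ∘ assocMul σ H hHfix Λ x =
      cosetMul σ H hHfix (assocProj H Λ x) ∘ assocProj H Λ := by
  funext z
  obtain ⟨a, u, rfl⟩ := exists_tmul x
  obtain ⟨b, v, rfl⟩ := exists_tmul z
  rfl

end Multiplication


/-! ### Vertical vectors and the fibre metric -/

section Geometry

variable {EG : Type*} [NormedAddCommGroup EG] [NormedSpace ℝ EG]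
  {G : Type*} [Group G] [TopologicalSpace G] [ChartedSpace EG G]
  {σ : G ≃* G} {H : Subgroup G}
  {EN : Type*} [NormedAddCommGroup EN] [NormedSpace ℝ EN]
  [ChartedSpace EN (G ⧸ H)]
  {EΛ : Type*} [NormedAddCommGroup EΛ] [NormedSpace ℝ EΛ]
  {Λ : Type*} [TopologicalSpace Λ] [ChartedSpace EΛ Λ] [MulAction H Λ]
  {EM : Type*} [NormedAddCommGroup EM] [NormedSpace ℝ EM]
  [ChartedSpace EM (AssocBundle H Λ)]

/-- The smooth structure of `G ×_H Λ` is compatible with the quotient map, the projection to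
`G ⧸ H` and the trivializations defined by smooth local sections of `G → G ⧸ H`. -/
structure IsSmoothAssocBundle (EG EN EΛ EM : Type*) [NormedAddCommGroup EG] [NormedSpace ℝ EG]
    [NormedAddCommGroup EN] [NormedSpace ℝ EN] [NormedAddCommGroup EΛ] [NormedSpace ℝ EΛ]
    [NormedAddCommGroup EM] [NormedSpace ℝ EM]
    {G : Type*} [Group G] [TopologicalSpace G] [ChartedSpace EG G] (H : Subgroup G)
    [ChartedSpace EN (G ⧸ H)] (Λ : Type*) [TopologicalSpace Λ] [ChartedSpace EΛ Λ] [MulAction H Λ]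
    [ChartedSpace EM (AssocBundle H Λ)] : Prop where
  contMDiff_tmul : ContMDiff (𝓘(ℝ, EG).prod 𝓘(ℝ, EΛ)) 𝓘(ℝ, EM) ∞
    (fun p : G × Λ => tmul H p.1 p.2)
  contMDiff_proj : ContMDiff 𝓘(ℝ, EM) 𝓘(ℝ, EN) ∞ (assocProj H Λ)
  contMDiffOn_triv : ∀ (s : G ⧸ H → G) (U : Set (G ⧸ H)) (hs : IsSmoothSection EG EN s U),
    ContMDiffOn 𝓘(ℝ, EM) 𝓘(ℝ, EΛ) ∞ (fun x => (assocTriv Λ hs.mk_apply x).2)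
      (assocProj H Λ ⁻¹' U)
  exists_section : ∀ a : G, ∃ (s : G ⧸ H → G) (U : Set (G ⧸ H)),
    IsSmoothSection EG EN s U ∧ QuotientGroup.mk a ∈ U ∧ s (QuotientGroup.mk a) = a

namespace IsSmoothAssocBundle

variable (hM : IsSmoothAssocBundle EG EN EΛ EM H Λ)

include hM

theorem contMDiff_tmul_right (b : G) : ContMDiff 𝓘(ℝ, EΛ) 𝓘(ℝ, EM) ∞ (tmul H b : Λ → _) :=
  hM.contMDiff_tmul.comp (contMDiff_const.prodMk contMDiff_id)

theorem mdifferentiable_tmul_right (b : G) :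
    MDifferentiable 𝓘(ℝ, EΛ) 𝓘(ℝ, EM) (tmul H b : Λ → _) :=
  (hM.contMDiff_tmul_right b).mdifferentiable (by simp)

theorem mdifferentiable_proj : MDifferentiable 𝓘(ℝ, EM) 𝓘(ℝ, EN) (assocProj H Λ) :=
  hM.contMDiff_proj.mdifferentiable (by simp)

theorem mdifferentiableAt_triv {s : G ⧸ H → G} {U : Set (G ⧸ H)} (hs : IsSmoothSection EG EN s U)
    {x : AssocBundle H Λ} (hx : assocProj H Λ x ∈ U) :
    MDifferentiableAt 𝓘(ℝ, EM) 𝓘(ℝ, EΛ) (fun x => (assocTriv Λ hs.mk_apply x).2) x :=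
  ((hM.contMDiffOn_triv s U hs).contMDiffAt ((hs.isOpen.preimage continuous_assocProj).mem_nhds
    hx)).mdifferentiableAt (by simp)

theorem contMDiffAt_section_proj {s : G ⧸ H → G} {U : Set (G ⧸ H)}
    (hs : IsSmoothSection EG EN s U) {x : AssocBundle H Λ} (hx : assocProj H Λ x ∈ U) :
    ContMDiffAt 𝓘(ℝ, EM) 𝓘(ℝ, EG) ∞ (fun x => s (assocProj H Λ x)) x :=
  (hs.contMDiffOn.contMDiffAt (hs.isOpen.mem_nhds hx)).comp x hM.contMDiff_proj.contMDiffAt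

theorem exists_section_proj (x : AssocBundle H Λ) : ∃ (s : G ⧸ H → G) (U : Set (G ⧸ H)),
    IsSmoothSection EG EN s U ∧ assocProj H Λ x ∈ U := by
  obtain ⟨a, u, rfl⟩ := exists_tmul x
  obtain ⟨s, U, hs, haU, -⟩ := hM.exists_section a
  exact ⟨s, U, hs, haU⟩

/-- A section `s` with `s(aH) = a` lifts `x` to its coordinates in `G × Λ`, which is a right inverse
of the quotient map passing through `(a, u)`. -/
theorem mfderiv_tmul_surjective (p : G × Λ) : Function.Surjective
    (mfderiv (𝓘(ℝ, EG).prod 𝓘(ℝ, EΛ)) 𝓘(ℝ, EM) (fun p : G × Λ => tmul H p.1 p.2) p) := by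
  obtain ⟨a, u⟩ := p
  obtain ⟨s, U, hs, haU, hsa⟩ := hM.exists_section a
  have hx : assocProj H Λ (tmul H a u) ∈ U := haU
  refine mfderiv_surjective_of_section (y := tmul H a u)
    (s := fun x => (s (assocProj H Λ x), (assocTriv Λ hs.mk_apply x).2)) ?_
    (hM.contMDiff_tmul.mdifferentiable (by simp) _)
    (((hM.contMDiffAt_section_proj hs hx).mdifferentiableAt (by simp)).prodMk
      (hM.mdifferentiableAt_triv hs hx)) (tmul_assocTriv hs.mk_apply)
  have h1 : fiberCoord s hs.mk_apply a = 1 := by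
    have := fiberCoord_section hs.mk_apply (QuotientGroup.mk a)
    rwa [hsa] at this
  rw [assocProj_tmul, assocTriv_tmul, hsa, h1, one_smul]

theorem mfderiv_proj_surjective (x : AssocBundle H Λ) :
    Function.Surjective (mfderiv 𝓘(ℝ, EM) 𝓘(ℝ, EN) (assocProj H Λ) x) := by
  obtain ⟨a, u, rfl⟩ := exists_tmul x
  obtain ⟨s, U, hs, haU, hsa⟩ := hM.exists_section a
  refine mfderiv_surjective_of_section (y := QuotientGroup.mk a) (s := fun y => tmul H (s y) u) ?_
    (hM.mdifferentiable_proj _) ?_ fun y => hs.mk_apply y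
  · rw [hsa]
  · have h1 : ContMDiffAt 𝓘(ℝ, EN) 𝓘(ℝ, EM) ∞ (fun y => tmul H (s y) u) (QuotientGroup.mk a) :=
      hM.contMDiff_tmul.contMDiffAt.comp _
        ((hs.contMDiffOn.contMDiffAt (hs.isOpen.mem_nhds haU)).prodMk contMDiffAt_const)
    exact h1.mdifferentiableAt (by simp)

theorem tderiv_proj_tmul (b : G) (u : Λ) (w : EΛ) :
    tderiv EM EN (assocProj H Λ) (tmul H b u) (tderiv EΛ EM (tmul H b) u w) = 0 := by
  rw [← tderiv_comp (hM.mdifferentiable_proj _) (hM.mdifferentiable_tmul_right b u) rfl]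
  exact tderiv_const (QuotientGroup.mk b : G ⧸ H) u w

/-- A vertical vector is the image of its fibre component in a trivialization. -/
theorem tderiv_tmul_triv {s : G ⧸ H → G} {U : Set (G ⧸ H)} (hs : IsSmoothSection EG EN s U)
    {x : AssocBundle H Λ} (hx : assocProj H Λ x ∈ U) {v : EM}
    (hv : tderiv EM EN (assocProj H Λ) x v = 0) :
    tderiv EΛ EM (tmul H (s (assocProj H Λ x))) (assocTriv Λ hs.mk_apply x).2
      (tderiv EM EΛ (fun x => (assocTriv Λ hs.mk_apply x).2) x v) = v := by
  -- Along a vertical vector the `G`-factor of `x = s(πx) ⊗ ρ(x)` is stationary, where `π` is the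
  -- projection and `ρ` the fibre coordinate; only the `Λ`-factor contributes to the derivative.
  have h1 : tderiv EM EG (fun x => s (assocProj H Λ x)) x v = 0 := by
    have h2 := tderiv_comp ((hs.contMDiffOn.contMDiffAt (hs.isOpen.mem_nhds hx)).mdifferentiableAt
      (by simp)) (hM.mdifferentiable_proj x) rfl v
    rw [hv, map_zero] at h2
    exact h2
  have h3 := tderiv_comp_prodMk (F := fun p : G × Λ => tmul H p.1 p.2) (x := x)
    (hM.contMDiff_tmul.mdifferentiable (by simp) _)
    ((hM.contMDiffAt_section_proj hs hx).mdifferentiableAt (by simp))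
    (hM.mdifferentiableAt_triv hs hx) h1
  refine h3.symm.trans ?_
  have h4 : (fun x : AssocBundle H Λ =>
      tmul H (s (assocProj H Λ x)) (assocTriv Λ hs.mk_apply x).2) = id :=
    funext (tmul_assocTriv hs.mk_apply)
  simp only [h4]
  exact tderiv_id x v

/-- A vertical vector with vanishing fibre component in a trivialization is zero. -/
theorem eq_zero_of_tderiv_triv {s : G ⧸ H → G} {U : Set (G ⧸ H)} (hs : IsSmoothSection EG EN s U)
    {x : AssocBundle H Λ} (hx : assocProj H Λ x ∈ U) {v : EM}
    (hv : tderiv EM EN (assocProj H Λ) x v = 0)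
    (hv' : tderiv EM EΛ (fun x => (assocTriv Λ hs.mk_apply x).2) x v = 0) : v = 0 := by
  rw [← hM.tderiv_tmul_triv hs hx hv, hv', map_zero]

/-- The trivializations are isometric along the fibres. -/
theorem form_tderiv_triv_tmul [IsManifold 𝓘(ℝ, EΛ) ∞ Λ] (gΛ : Metric EΛ Λ)
    (hisom : ∀ h : H, IsRiemannianIsometry gΛ (fun u => h • u))
    {s : G ⧸ H → G} {U : Set (G ⧸ H)} (hs : IsSmoothSection EG EN s U)
    {b : G} (hb : QuotientGroup.mk b ∈ U) (u : Λ) (w w' : EΛ) :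
    gΛ.form (assocTriv Λ hs.mk_apply (tmul H b u)).2
      (tderiv EM EΛ (fun x => (assocTriv Λ hs.mk_apply x).2) (tmul H b u)
        (tderiv EΛ EM (tmul H b) u w))
      (tderiv EM EΛ (fun x => (assocTriv Λ hs.mk_apply x).2) (tmul H b u)
        (tderiv EΛ EM (tmul H b) u w')) = gΛ.form u w w' := by
  have h1 := fun w => tderiv_comp (hM.mdifferentiableAt_triv hs (x := tmul H b u) hb)
    (hM.mdifferentiable_tmul_right b u) rfl w
  rw [← h1, ← h1]
  -- The fibre coordinate of `b ⊗ u` is the image of `u` under a fixed element of `H`, which acts as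
  -- an isometry.
  exact (hisom (fiberCoord s hs.mk_apply b)).2 u w w'

/-- The fibre metric on vertical vectors does not depend on the trivialization. -/
theorem form_tderiv_triv_eq [IsManifold 𝓘(ℝ, EΛ) ∞ Λ] (gΛ : Metric EΛ Λ)
    (hisom : ∀ h : H, IsRiemannianIsometry gΛ (fun u => h • u))
    {s s' : G ⧸ H → G} {U U' : Set (G ⧸ H)} (hs : IsSmoothSection EG EN s U)
    (hs' : IsSmoothSection EG EN s' U') {x : AssocBundle H Λ} (hx : assocProj H Λ x ∈ U)
    (hx' : assocProj H Λ x ∈ U') {v v' : EM}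
    (hv : tderiv EM EN (assocProj H Λ) x v = 0) (hv' : tderiv EM EN (assocProj H Λ) x v' = 0) :
    gΛ.form (assocTriv Λ hs'.mk_apply x).2
      (tderiv EM EΛ (fun x => (assocTriv Λ hs'.mk_apply x).2) x v)
      (tderiv EM EΛ (fun x => (assocTriv Λ hs'.mk_apply x).2) x v') =
    gΛ.form (assocTriv Λ hs.mk_apply x).2
      (tderiv EM EΛ (fun x => (assocTriv Λ hs.mk_apply x).2) x v)
      (tderiv EM EΛ (fun x => (assocTriv Λ hs.mk_apply x).2) x v') := by
  have h1 := hM.form_tderiv_triv_tmul gΛ hisom hs' (b := s (assocProj H Λ x))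
    (by rwa [hs.mk_apply]) (assocTriv Λ hs.mk_apply x).2
    (tderiv EM EΛ (fun x => (assocTriv Λ hs.mk_apply x).2) x v)
    (tderiv EM EΛ (fun x => (assocTriv Λ hs.mk_apply x).2) x v')
  rw [hM.tderiv_tmul_triv hs hx hv, hM.tderiv_tmul_triv hs hx hv'] at h1
  rwa [tmul_assocTriv] at h1

/-- Local sections near both factors give smooth representatives in `G × Λ`, for which the product
is an explicit formula. -/
theorem contMDiff_assocMul [LieGroup 𝓘(ℝ, EG) ∞ G] (hσ : ContMDiff 𝓘(ℝ, EG) 𝓘(ℝ, EG) ∞ σ)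
    (hHfix : ∀ h ∈ H, σ h = h) :
    ContMDiff (𝓘(ℝ, EM).prod 𝓘(ℝ, EM)) 𝓘(ℝ, EM) ∞
      (fun p : AssocBundle H Λ × AssocBundle H Λ => assocMul σ H hHfix Λ p.1 p.2) := by
  rintro ⟨x, y⟩
  obtain ⟨s, U, hs, hx⟩ := hM.exists_section_proj x
  obtain ⟨s', U', hs', hy⟩ := hM.exists_section_proj y
  have hA : ContMDiffAt (𝓘(ℝ, EM).prod 𝓘(ℝ, EM)) 𝓘(ℝ, EG) ∞
      (fun p : AssocBundle H Λ × AssocBundle H Λ => s (assocProj H Λ p.1)) (x, y) :=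
    ContMDiffAt.comp (g := fun x => s (assocProj H Λ x)) (x, y)
      (hM.contMDiffAt_section_proj hs hx) contMDiffAt_fst
  have hB : ContMDiffAt (𝓘(ℝ, EM).prod 𝓘(ℝ, EM)) 𝓘(ℝ, EG) ∞
      (fun p : AssocBundle H Λ × AssocBundle H Λ => s' (assocProj H Λ p.2)) (x, y) :=
    ContMDiffAt.comp (g := fun x => s' (assocProj H Λ x)) (x, y)
      (hM.contMDiffAt_section_proj hs' hy) contMDiffAt_snd
  have hv : ContMDiffAt (𝓘(ℝ, EM).prod 𝓘(ℝ, EM)) 𝓘(ℝ, EΛ) ∞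
      (fun p : AssocBundle H Λ × AssocBundle H Λ => (assocTriv Λ hs'.mk_apply p.2).2) (x, y) :=
    ContMDiffAt.comp (g := fun x => (assocTriv Λ hs'.mk_apply x).2) (x, y)
      ((hM.contMDiffOn_triv s' U' hs').contMDiffAt
        ((hs'.isOpen.preimage continuous_assocProj).mem_nhds hy)) contMDiffAt_snd
  have h1 := hM.contMDiff_tmul.contMDiffAt.comp (x, y)
    (((hA.mul (hσ.contMDiffAt.comp (x, y) hA).inv).mul (hσ.contMDiffAt.comp (x, y) hB)).prodMk hv)
  refine h1.congr_of_eventuallyEq (Filter.Eventually.of_forall fun p => ?_)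
  have h2 := assocMul_tmul σ H hHfix (s (assocProj H Λ p.1)) (s' (assocProj H Λ p.2))
    (assocTriv Λ hs.mk_apply p.1).2 (assocTriv Λ hs'.mk_apply p.2).2
  rw [tmul_assocTriv, tmul_assocTriv] at h2
  exact h2

end IsSmoothAssocBundle

end Geometry


section SectionSum

variable {E : Type*} [NormedAddCommGroup E] [NormedSpace ℝ E]
  {M : Type*} [TopologicalSpace M] [ChartedSpace E M] [IsManifold 𝓘(ℝ, E) ∞ M]

theorem contMDiffAt_average {s : M → M → M} (hs : ∀ x, s x x = x)
    (hS : ContMDiff 𝓘(ℝ, E).tangent 𝓘(ℝ, E).tangent ∞ (symmetryTensor E s)) (k : ℕ) {x₀ : M}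
    {V : M → E} (hV : ContMDiffAt 𝓘(ℝ, E) 𝓘(ℝ, E).tangent ∞
      (fun x => (⟨x, V x⟩ : TangentBundle 𝓘(ℝ, E) M)) x₀) :
    ContMDiffAt 𝓘(ℝ, E) 𝓘(ℝ, E).tangent ∞
      (fun x => (⟨x, average k (fixedDeriv 𝓘(ℝ, E) (s x) x) (V x)⟩ :
        TangentBundle 𝓘(ℝ, E) M)) x₀ := by
  have h1 : ∀ j : ℕ, ContMDiffAt 𝓘(ℝ, E) 𝓘(ℝ, E).tangent ∞
      (fun x => (⟨x, (fixedDeriv 𝓘(ℝ, E) (s x) x ^ j) (V x)⟩ : TangentBundle 𝓘(ℝ, E) M)) x₀ := by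
    intro j
    induction j with
    | zero => exact hV
    | succ j ih =>
      refine (hS.contMDiffAt.comp x₀ ih).congr_of_eventuallyEq
        (Filter.Eventually.of_forall fun x => ?_)
      have h2 : (fixedDeriv 𝓘(ℝ, E) (s x) x ^ (j + 1)) (V x) = fixedDeriv 𝓘(ℝ, E) (s x) x
        ((fixedDeriv 𝓘(ℝ, E) (s x) x ^ j) (V x)) := by rw [pow_succ']; rfl
      rw [Function.comp_apply, symmetryTensor_eq hs]
      exact congrArg (TotalSpace.mk x) h2
  have h2 := (ContMDiffAt.sum_section (V := (TangentSpace 𝓘(ℝ, E) : M → Type _))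
    (s := Finset.range k) fun j _ => h1 j).const_smul_section (a := (k : ℝ)⁻¹)
  refine h2.congr_of_eventuallyEq (Filter.Eventually.of_forall fun x => ?_)
  exact congrArg (TotalSpace.mk x) (average_apply k _ (V x))

end SectionSum

/-! ### The metric on `G ×_H Λ` -/

section Geometry

variable {EG : Type*} [NormedAddCommGroup EG] [NormedSpace ℝ EG]
  {G : Type*} [Group G] [TopologicalSpace G] [ChartedSpace EG G]
  {σ : G ≃* G} {H : Subgroup G}
  {EN : Type*} [NormedAddCommGroup EN] [NormedSpace ℝ EN]
  [ChartedSpace EN (G ⧸ H)] [IsManifold 𝓘(ℝ, EN) ∞ (G ⧸ H)]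
  {EΛ : Type*} [NormedAddCommGroup EΛ] [NormedSpace ℝ EΛ]
  {Λ : Type*} [TopologicalSpace Λ] [ChartedSpace EΛ Λ] [MulAction H Λ]
  [IsManifold 𝓘(ℝ, EΛ) ∞ Λ]
  {EM : Type*} [NormedAddCommGroup EM] [NormedSpace ℝ EM]
  [ChartedSpace EM (AssocBundle H Λ)] [IsManifold 𝓘(ℝ, EM) ∞ (AssocBundle H Λ)]

/-- `g` is the orthogonal sum of the pull-back of the metric of `G ⧸ H` and of the fibre metric,
transported to the tangent bundle by the field `P` of projections on the vertical subspaces. -/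
def IsSumMetric (gN : Metric EN (G ⧸ H)) (gΛ : Metric EΛ Λ) (P : AssocBundle H Λ → EM →L[ℝ] EM)
    (EG : Type*) [NormedAddCommGroup EG] [NormedSpace ℝ EG] [ChartedSpace EG G]
    (g : Metric EM (AssocBundle H Λ)) : Prop :=
  ∀ (s : G ⧸ H → G) (U : Set (G ⧸ H)) (hs : IsSmoothSection EG EN s U) (x : AssocBundle H Λ),
    assocProj H Λ x ∈ U → ∀ v w : EM, g.form x v w =
      gN.form (assocProj H Λ x) (tderiv EM EN (assocProj H Λ) x v)
        (tderiv EM EN (assocProj H Λ) x w) +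
      gΛ.form (assocTriv Λ hs.mk_apply x).2
        (tderiv EM EΛ (fun x => (assocTriv Λ hs.mk_apply x).2) x (P x v))
        (tderiv EM EΛ (fun x => (assocTriv Λ hs.mk_apply x).2) x (P x w))

/-- The form is defined with a section chosen separately at each point. Independence of the section
lets a single one serve near `x₀`, which gives smoothness. If both summands vanish on `v`, then `v`
is vertical, so `P v = v` has zero fibre component and `v = 0`. -/
theorem IsSmoothAssocBundle.exists_isSumMetric [FiniteDimensional ℝ EM]
    (hM : IsSmoothAssocBundle EG EN EΛ EM H Λ) (gN : Metric EN (G ⧸ H)) (gΛ : Metric EΛ Λ)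
    (hisom : ∀ h : H, IsRiemannianIsometry gΛ (fun u => h • u))
    (P : AssocBundle H Λ → EM →L[ℝ] EM)
    (hP : ∀ x v, tderiv EM EN (assocProj H Λ) x (P x v) = 0)
    (hP' : ∀ x v, tderiv EM EN (assocProj H Λ) x v = 0 → P x v = v)
    (hPs : ∀ (x₀ : AssocBundle H Λ) (V : AssocBundle H Λ → EM),
      ContMDiffAt 𝓘(ℝ, EM) 𝓘(ℝ, EM).tangent ∞
        (fun x => (⟨x, V x⟩ : TangentBundle 𝓘(ℝ, EM) (AssocBundle H Λ))) x₀ →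
      ContMDiffAt 𝓘(ℝ, EM) 𝓘(ℝ, EM).tangent ∞
        (fun x => (⟨x, P x (V x)⟩ : TangentBundle 𝓘(ℝ, EM) (AssocBundle H Λ))) x₀) :
    ∃ g : Metric EM (AssocBundle H Λ), IsSumMetric gN gΛ P EG g := by
  choose s U hs hU using hM.exists_section_proj
  let ρ : AssocBundle H Λ → AssocBundle H Λ → Λ := fun x z => (assocTriv Λ (hs x).mk_apply z).2
  let b : AssocBundle H Λ → EM →L[ℝ] EM →L[ℝ] ℝ := fun x =>
    (gN.form (assocProj H Λ x)).bilinearComp (tderiv EM EN (assocProj H Λ) x)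
      (tderiv EM EN (assocProj H Λ) x) +
    (gΛ.form (ρ x x)).bilinearComp ((tderiv EM EΛ (ρ x) x).comp (P x))
      ((tderiv EM EΛ (ρ x) x).comp (P x))
  have hb : ∀ x v w, b x v w = gN.form (assocProj H Λ x) (tderiv EM EN (assocProj H Λ) x v)
        (tderiv EM EN (assocProj H Λ) x w) +
      gΛ.form (ρ x x) (tderiv EM EΛ (ρ x) x (P x v)) (tderiv EM EΛ (ρ x) x (P x w)) :=
    fun x v w => rfl
  have hb' : ∀ (s : G ⧸ H → G) (U : Set (G ⧸ H)) (hs : IsSmoothSection EG EN s U)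
      (x : AssocBundle H Λ), assocProj H Λ x ∈ U → ∀ v w : EM, b x v w =
      gN.form (assocProj H Λ x) (tderiv EM EN (assocProj H Λ) x v)
        (tderiv EM EN (assocProj H Λ) x w) +
      gΛ.form (assocTriv Λ hs.mk_apply x).2
        (tderiv EM EΛ (fun x => (assocTriv Λ hs.mk_apply x).2) x (P x v))
        (tderiv EM EΛ (fun x => (assocTriv Λ hs.mk_apply x).2) x (P x w)) := by
    intro s' U' hs' x hx v w
    rw [hb]
    congr 1
    exact hM.form_tderiv_triv_eq gΛ hisom hs' (hs x) hx (hU x) (hP x v) (hP x w)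
  have hpos : ∀ x (v : EM), v ≠ 0 → 0 < b x v v := by
    intro x v hv
    rw [hb]
    have h1 := gN.form_self_nonneg (assocProj H Λ x) (tderiv EM EN (assocProj H Λ) x v)
    have h2 := gΛ.form_self_nonneg (ρ x x) (tderiv EM EΛ (ρ x) x (P x v))
    refine lt_of_le_of_ne (add_nonneg h1 h2) fun h0 => hv ?_
    have h3 := (add_eq_zero_iff_of_nonneg h1 h2).1 h0.symm
    have h4 := gN.form_self_eq_zero h3.1
    have h5 := gΛ.form_self_eq_zero h3.2
    rw [hP' x v h4] at h5
    exact hM.eq_zero_of_tderiv_triv (hs x) (hU x) h4 h5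
  have hsmooth : ContMDiff 𝓘(ℝ, EM) (𝓘(ℝ, EM).prod 𝓘(ℝ, EM →L[ℝ] EM →L[ℝ] ℝ)) ∞
      (fun x => TotalSpace.mk' (EM →L[ℝ] EM →L[ℝ] ℝ)
        (E := fun x : AssocBundle H Λ => TangentSpace 𝓘(ℝ, EM) x →L[ℝ]
          TangentSpace 𝓘(ℝ, EM) x →L[ℝ] ℝ) x (b x)) := by
    intro x₀
    refine contMDiffAt_bilinForm_of_apply (E₁ := fun x : AssocBundle H Λ =>
      TangentSpace 𝓘(ℝ, EM) x) (b := b) fun V W hV hW => ?_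
    have h1 := contMDiffAt_form_tderiv gN isOpen_univ hM.contMDiff_proj.contMDiffOn
      (Set.mem_univ x₀) hV hW
    have hUo := (hs x₀).isOpen.preimage (continuous_assocProj (H := H) (Λ := Λ))
    have h2 := contMDiffAt_form_tderiv gΛ hUo (hM.contMDiffOn_triv (s x₀) (U x₀) (hs x₀))
      (hU x₀) (hPs x₀ V hV) (hPs x₀ W hW)
    refine (h1.add h2).congr_of_eventuallyEq ?_
    filter_upwards [hUo.mem_nhds (hU x₀)] with x hx
    exact hb' _ _ (hs x₀) x hx (V x) (W x)
  refine ⟨⟨b, fun x (v w : EM) => ?_, hpos, fun x => ?_, hsmooth⟩, hb'⟩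
  · change b x v w = b x w v
    rw [hb, hb]
    congr 1
    · exact gN.symm _ _ _
    · exact gΛ.symm _ _ _
  · exact isVonNBounded_of_pos (b x) (hpos x)

namespace IsSumMetric

variable {gN : Metric EN (G ⧸ H)} {gΛ : Metric EΛ Λ} {P : AssocBundle H Λ → EM →L[ℝ] EM}
  {g : Metric EM (AssocBundle H Λ)}

theorem preservesMetric_tmul (hg : IsSumMetric gN gΛ P EG g)
    (hM : IsSmoothAssocBundle EG EN EΛ EM H Λ)
    (hisom : ∀ h : H, IsRiemannianIsometry gΛ (fun u => h • u))
    (hP' : ∀ x v, tderiv EM EN (assocProj H Λ) x v = 0 → P x v = v) (a : G) :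
    PreservesMetric gΛ g (fun u : Λ => tmul H a u) := by
  refine fun u (v w : EΛ) => ?_
  obtain ⟨s, U, hs, haU, -⟩ := hM.exists_section a
  have h1 := hg s U hs (tmul H a u) haU (tderiv EΛ EM (tmul H a) u v) (tderiv EΛ EM (tmul H a) u w)
  have hv := hM.tderiv_proj_tmul a u v
  have hw := hM.tderiv_proj_tmul a u w
  rw [hP' _ _ hv, hP' _ _ hw, hv, map_zero, zero_apply, zero_add,
    hM.form_tderiv_triv_tmul gΛ hisom hs haU] at h1
  exact h1

/-- A vector `v` orthogonal to the kernel is orthogonal to `P v`, which forces the fibre component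
of `P v` to vanish. Only the pull-back of `gN` then remains. -/
theorem isRiemannianSubmersion (hg : IsSumMetric gN gΛ P EG g)
    (hM : IsSmoothAssocBundle EG EN EΛ EM H Λ)
    (hP : ∀ x v, tderiv EM EN (assocProj H Λ) x (P x v) = 0)
    (hP' : ∀ x v, tderiv EM EN (assocProj H Λ) x v = 0 → P x v = v) :
    IsRiemannianSubmersion g gN (assocProj H Λ) where
  contMDiff := hM.contMDiff_proj
  surjective := hM.mfderiv_proj_surjective
  isometric := by
    refine fun x (v w : EM) hv hw => ?_
    obtain ⟨s, U, hs, hx⟩ := hM.exists_section_proj x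
    have h1 : g.form x v (P x v) = 0 := hv (P x v) (hP x v)
    rw [hg s U hs x hx, hP, map_zero, zero_add, hP' x _ (hP x v)] at h1
    have h2 := hg s U hs x hx v w
    rw [gΛ.form_self_eq_zero h1, map_zero, zero_apply, add_zero] at h2
    exact h2.symm

/-- A map of `G ×_H Λ` which commutes with the projections on the vertical subspaces, covers an
isometry and is given by `b ⊗ u ↦ b' ⊗ u` on fibres preserves the metric. -/
theorem preservesMetric (hg : IsSumMetric gN gΛ P EG g)
    (hM : IsSmoothAssocBundle EG EN EΛ EM H Λ)
    (hisom : ∀ h : H, IsRiemannianIsometry gΛ (fun u => h • u))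
    (hP : ∀ x v, tderiv EM EN (assocProj H Λ) x (P x v) = 0)
    {f : AssocBundle H Λ → AssocBundle H Λ} (hf : MDifferentiable 𝓘(ℝ, EM) 𝓘(ℝ, EM) f)
    {f' : G ⧸ H → G ⧸ H} (hf' : MDifferentiable 𝓘(ℝ, EN) 𝓘(ℝ, EN) f')
    (hf'g : PreservesMetric gN gN f') (hff' : assocProj H Λ ∘ f = f' ∘ assocProj H Λ)
    (hfib : ∀ b, ∃ b', f ∘ tmul H b = tmul H b')
    (hPf : ∀ x v, P (f x) (tderiv EM EM f x v) = tderiv EM EM f x (P x v)) :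
    PreservesMetric g g f := by
  refine fun x (v w : EM) => ?_
  obtain ⟨s, U, hs, hx⟩ := hM.exists_section_proj x
  obtain ⟨s', U', hs', hx'⟩ := hM.exists_section_proj (f x)
  obtain ⟨b', hb'⟩ := hfib (s (assocProj H Λ x))
  change g.form (f x) (tderiv EM EM f x v) (tderiv EM EM f x w) = g.form x v w
  rw [hg s U hs x hx, hg s' U' hs' (f x) hx', hPf, hPf]
  have h1 : ∀ v, tderiv EM EN (assocProj H Λ) (f x) (tderiv EM EM f x v) =
      tderiv EN EN f' (assocProj H Λ x) (tderiv EM EN (assocProj H Λ) x v) := fun v => by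
    rw [← tderiv_comp (hM.mdifferentiable_proj _) (hf x) rfl, hff',
      tderiv_comp (hf' _) (hM.mdifferentiable_proj x) rfl]
  have h2 : assocProj H Λ (f x) = f' (assocProj H Λ x) := congrFun hff' x
  congr 1
  · rw [h1, h1, h2]
    exact hf'g _ _ _
  · set u := (assocTriv Λ hs.mk_apply x).2 with hu
    have hxu : tmul H (s (assocProj H Λ x)) u = x := tmul_assocTriv hs.mk_apply x
    have hfx : tmul H b' u = f x := by rw [← hb', Function.comp_apply, hxu]
    -- On vertical vectors `f` acts only by replacing `b` with `b'`, so the fibre component in `Λ`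
    -- is unchanged.
    have h3 : ∀ v, tderiv EM EM f x (P x v) = tderiv EΛ EM (tmul H b') u
        (tderiv EM EΛ (fun x => (assocTriv Λ hs.mk_apply x).2) x (P x v)) := by
      intro v
      rw [← hb', tderiv_comp (hf x) (hM.mdifferentiable_tmul_right _ u) hxu,
        hM.tderiv_tmul_triv hs hx (hP x v)]
    rw [h3, h3, ← hfx]
    refine hM.form_tderiv_triv_tmul gΛ hisom hs' ?_ u _ _
    rwa [← hfx] at hx'

end IsSumMetric

end Geometry


/-! ### The average of the powers of `S` as vertical projection -/

section Symmetries

variable {EG : Type*} [NormedAddCommGroup EG] [NormedSpace ℝ EG]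
  {G : Type*} [Group G] [TopologicalSpace G] [ChartedSpace EG G]
  {σ : G ≃* G} {H : Subgroup G}
  {EN : Type*} [NormedAddCommGroup EN] [NormedSpace ℝ EN]
  [ChartedSpace EN (G ⧸ H)]
  {EΛ : Type*} [NormedAddCommGroup EΛ] [NormedSpace ℝ EΛ]
  {Λ : Type*} [TopologicalSpace Λ] [ChartedSpace EΛ Λ] [MulAction H Λ]
  {EM : Type*} [NormedAddCommGroup EM] [NormedSpace ℝ EM]
  [ChartedSpace EM (AssocBundle H Λ)]

/-- The differentials of the symmetries of `G ×_H Λ` commute with the tensor field `S`. -/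
theorem tderiv_symmetry_comm {hHfix : ∀ h ∈ H, σ h = h}
    (hd : ∀ x, MDifferentiable 𝓘(ℝ, EM) 𝓘(ℝ, EM) (assocMul σ H hHfix Λ x))
    (x y : AssocBundle H Λ) (v : EM) :
    tderiv EM EM (assocMul σ H hHfix Λ y) x
      (fixedDeriv 𝓘(ℝ, EM) (assocMul σ H hHfix Λ x) x v) =
    fixedDeriv 𝓘(ℝ, EM) (assocMul σ H hHfix Λ (assocMul σ H hHfix Λ y x))
      (assocMul σ H hHfix Λ y x) (tderiv EM EM (assocMul σ H hHfix Λ y) x v) :=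
  tderiv_eq_of_comp_eq (hd y x) (hd x x) (assocMul_self hHfix x) (hd _ _) (hd y x) rfl
    (assocMul_distrib hHfix y x) v

/-- The average of the powers of the symmetry `S` is a projection on the vertical subspaces. -/
theorem IsSmoothAssocBundle.tderiv_proj_average [LieGroup 𝓘(ℝ, EG) ∞ G] [CompleteSpace EG]
    [IsManifold 𝓘(ℝ, EN) ∞ (G ⧸ H)]
    (hM : IsSmoothAssocBundle EG EN EΛ EM H Λ)
    (hσ : ContMDiff 𝓘(ℝ, EG) 𝓘(ℝ, EG) ∞ σ) {k : ℕ} (hk : 0 < k)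
    (hσk : ∀ a : G, σ^[k] a = a) (hHfix : ∀ h ∈ H, σ h = h)
    (hHcomp : connectedComponentIn {a : G | σ a = a} 1 ⊆ (H : Set G))
    (hN : Manifold.IsSubmersion 𝓘(ℝ, EG) 𝓘(ℝ, EN) ∞ (QuotientGroup.mk : G → G ⧸ H))
    (hsN : ∀ y : G ⧸ H, ContMDiff 𝓘(ℝ, EN) 𝓘(ℝ, EN) ∞ (cosetMul σ H hHfix y))
    (hgN : ∀ a : G, ContMDiff 𝓘(ℝ, EN) 𝓘(ℝ, EN) ∞ (fun y : G ⧸ H => a • y))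
    (hd : ∀ x, MDifferentiable 𝓘(ℝ, EM) 𝓘(ℝ, EM) (assocMul σ H hHfix Λ x))
    (x : AssocBundle H Λ) (v : EM) :
    tderiv EM EN (assocProj H Λ) x
      (average k (fixedDeriv 𝓘(ℝ, EM) (assocMul σ H hHfix Λ x) x) v) = 0 := by
  -- The average is fixed by `S`, so its projection is fixed by the differential of the symmetry of
  -- `G ⧸ H`.
  refine eq_zero_of_fixed hσ hk hσk hHfix hHcomp hN hsN hgN (assocProj H Λ x) ?_
  have h1 := tderiv_eq_of_comp_eq ((hsN (assocProj H Λ x)).mdifferentiable (by simp) _)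
    (hM.mdifferentiable_proj x) rfl (hM.mdifferentiable_proj x) (hd x x)
    (assocMul_self hHfix x) (assocProj_comp_assocMul hHfix x).symm
    (average k (fixedDeriv 𝓘(ℝ, EM) (assocMul σ H hHfix Λ x) x) v)
  refine h1.trans (congrArg _ (map_average ?_))
  rw [FunLike.coe_pow_eq_iterate]
  exact fixedDeriv_iterate_eq_self (hd x x) (assocMul_self hHfix x)
    (assocMul_iterate hHfix hσk x) v

/-- The symmetry at `x` fixes every point of the fibre through `x`, so `S` is the identity on
vertical vectors. -/
theorem IsSmoothAssocBundle.average_eq_self (hM : IsSmoothAssocBundle EG EN EΛ EM H Λ)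
    {k : ℕ} (hk : 0 < k) (hHfix : ∀ h ∈ H, σ h = h)
    (hd : ∀ x, MDifferentiable 𝓘(ℝ, EM) 𝓘(ℝ, EM) (assocMul σ H hHfix Λ x))
    (x : AssocBundle H Λ) (v : EM) (hv : tderiv EM EN (assocProj H Λ) x v = 0) :
    average k (fixedDeriv 𝓘(ℝ, EM) (assocMul σ H hHfix Λ x) x) v = v := by
  refine SigmaManifold.average_eq_self hk ?_
  obtain ⟨s, U, hs, hx⟩ := hM.exists_section_proj x
  have h1 := hM.tderiv_tmul_triv hs hx hv
  have hxu := tmul_assocTriv hs.mk_apply x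
  rw [← h1]
  have h2 : assocMul σ H hHfix Λ x ∘ tmul H (s (assocProj H Λ x)) =
      tmul H (s (assocProj H Λ x)) := by
    have h3 := assocMul_comp_tmul hHfix (s (assocProj H Λ x)) (s (assocProj H Λ x))
      (assocTriv Λ hs.mk_apply x).2
    rwa [hxu, inv_mul_cancel_right] at h3
  refine (tderiv_comp (hd x x) (hM.mdifferentiable_tmul_right _ _) hxu _).symm.trans ?_
  rw [h2]

end Symmetries

end SigmaManifold

theorem theorem4p43
    -- the connected Lie group `G`
    {EG : Type*} [NormedAddCommGroup EG] [NormedSpace ℝ EG] [FiniteDimensional ℝ EG]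
    {G : Type*} [Group G] [TopologicalSpace G] [ChartedSpace EG G] [LieGroup 𝓘(ℝ, EG) ∞ G]
    [T2Space G] [SecondCountableTopology G] [ConnectedSpace G]
    -- the smooth automorphism `σ` of `G` with `σ ^ k = id`
    (k : ℕ) (hk : 0 < k) (σ : G ≃* G) (hσ : ContMDiff 𝓘(ℝ, EG) 𝓘(ℝ, EG) ∞ σ)
    (hσk : ∀ a : G, σ^[k] a = a)
    -- the closed subgroup `H`, with its structure of embedded Lie subgroup,
    -- between the fixed point group of `σ` and its identity component
    (H : Subgroup G) (hHclosed : IsClosed (H : Set G))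
    {EH : Type*} [NormedAddCommGroup EH] [NormedSpace ℝ EH] [FiniteDimensional ℝ EH]
    [ChartedSpace EH H] [LieGroup 𝓘(ℝ, EH) ∞ H]
    (hHemb : Manifold.IsSmoothEmbedding 𝓘(ℝ, EH) 𝓘(ℝ, EG) ∞ (Subtype.val : H → G))
    (hHfix : ∀ h ∈ H, σ h = h)
    (hHcomp : connectedComponentIn {a : G | σ a = a} 1 ⊆ (H : Set G))
    -- the Riemannian manifold `N = G ⧸ H`, with the quotient manifold structure and a metric
    -- for which `G` acts by isometries and the symmetries defined by `σ` are isometries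
    {EN : Type*} [NormedAddCommGroup EN] [NormedSpace ℝ EN] [FiniteDimensional ℝ EN]
    [ChartedSpace EN (G ⧸ H)] [IsManifold 𝓘(ℝ, EN) ∞ (G ⧸ H)]
    (hN : Manifold.IsSubmersion 𝓘(ℝ, EG) 𝓘(ℝ, EN) ∞ (QuotientGroup.mk : G → G ⧸ H))
    (gN : SigmaManifold.Metric EN (G ⧸ H))
    (hgN : ∀ a : G, SigmaManifold.IsRiemannianIsometry gN (fun y => a • y))
    (hsN : ∀ y : G ⧸ H, SigmaManifold.IsRiemannianIsometry gN
      (SigmaManifold.cosetMul σ H hHfix y))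
    -- the connected Riemannian manifold `Λ`, on which `H` acts smoothly by isometries
    {EΛ : Type*} [NormedAddCommGroup EΛ] [NormedSpace ℝ EΛ] [FiniteDimensional ℝ EΛ]
    {Λ : Type*} [TopologicalSpace Λ] [ChartedSpace EΛ Λ] [IsManifold 𝓘(ℝ, EΛ) ∞ Λ]
    [T2Space Λ] [SecondCountableTopology Λ] [ConnectedSpace Λ]
    (gΛ : SigmaManifold.Metric EΛ Λ) [MulAction H Λ]
    (hact : ContMDiff (𝓘(ℝ, EH).prod 𝓘(ℝ, EΛ)) 𝓘(ℝ, EΛ) ∞ (fun p : H × Λ => p.1 • p.2))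
    (hisom : ∀ h : H, SigmaManifold.IsRiemannianIsometry gΛ (fun u => h • u)) :
    -- the quotient topology on `M = G ×_H Λ` is that of a manifold, ...
    T2Space (SigmaManifold.AssocBundle H Λ) ∧
    SecondCountableTopology (SigmaManifold.AssocBundle H Λ) ∧
    -- ... which has a smooth structure making `(a, u) ↦ a ⊗ u` a submersion ...
    ∃ (_ : ChartedSpace (EN × EΛ) (SigmaManifold.AssocBundle H Λ))
      (_ : IsManifold 𝓘(ℝ, EN × EΛ) ∞ (SigmaManifold.AssocBundle H Λ)),
      ContMDiff (𝓘(ℝ, EG).prod 𝓘(ℝ, EΛ)) 𝓘(ℝ, EN × EΛ) ∞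
        (fun p : G × Λ => SigmaManifold.tmul H p.1 p.2) ∧
      (∀ p : G × Λ, Function.Surjective
        (mfderiv (𝓘(ℝ, EG).prod 𝓘(ℝ, EΛ)) 𝓘(ℝ, EN × EΛ)
          (fun p : G × Λ => SigmaManifold.tmul H p.1 p.2) p)) ∧
      -- ... and a metric for which all `Λ → M`, `u ↦ a ⊗ u`, are isometric and `M → N` is a
      -- Riemannian submersion, and which makes `M` a regular `σ`-manifold of order `k`
      ∃ g : SigmaManifold.Metric (EN × EΛ) (SigmaManifold.AssocBundle H Λ),
        (∀ a : G, SigmaManifold.PreservesMetric gΛ g (fun u : Λ => SigmaManifold.tmul H a u)) ∧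
        SigmaManifold.IsRiemannianSubmersion g gN (SigmaManifold.assocProj H Λ) ∧
        SigmaManifold.IsRegularSigmaManifold k g (SigmaManifold.assocMul σ H hHfix Λ) := by
  have := topologicalGroup_of_lieGroup 𝓘(ℝ, EG) ∞ (G := G)
  have : ContinuousSMul H Λ := ⟨hact.continuous⟩
  refine ⟨SigmaManifold.t2Space_assocBundle hHclosed,
    SigmaManifold.secondCountableTopology_assocBundle, ?_⟩
  obtain ⟨cs, hm, hq, hπ, hρ⟩ := SigmaManifold.exists_isManifold_assocBundle hHemb hN hact
  have hM : SigmaManifold.IsSmoothAssocBundle EG EN EΛ (EN × EΛ) H Λ :=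
    ⟨hq, hπ, hρ, SigmaManifold.exists_isSmoothSection hN⟩
  have hsN' : ∀ y : G ⧸ H, ContMDiff 𝓘(ℝ, EN) 𝓘(ℝ, EN) ∞ (SigmaManifold.cosetMul σ H hHfix y) := by
    intro y
    obtain ⟨Φ, hΦ⟩ := (hsN y).1
    exact hΦ ▸ Φ.contMDiff
  have hgN' : ∀ a : G, ContMDiff 𝓘(ℝ, EN) 𝓘(ℝ, EN) ∞ (fun y : G ⧸ H => a • y) := by
    intro a
    obtain ⟨Φ, hΦ⟩ := (hgN a).1
    exact hΦ ▸ Φ.contMDiff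
  have hmul := hM.contMDiff_assocMul hσ hHfix
  have hs : ∀ x, ContMDiff 𝓘(ℝ, EN × EΛ) 𝓘(ℝ, EN × EΛ) ∞ (SigmaManifold.assocMul σ H hHfix Λ x) :=
    fun x => hmul.comp (contMDiff_const.prodMk contMDiff_id)
  have hd : ∀ x, MDifferentiable 𝓘(ℝ, EN × EΛ) 𝓘(ℝ, EN × EΛ)
      (SigmaManifold.assocMul σ H hHfix Λ x) := fun x => (hs x).mdifferentiable (by simp)
  have hself := SigmaManifold.assocMul_self (Λ := Λ) hHfix
  have hit := SigmaManifold.assocMul_iterate (Λ := Λ) hHfix hσk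
  have hS := SigmaManifold.contMDiff_symmetryTensor hmul
  have hP := hM.tderiv_proj_average hσ hk hσk hHfix hHcomp hN hsN' hgN' hd
  have hP' := hM.average_eq_self hk hHfix hd
  obtain ⟨g, hg⟩ := hM.exists_isSumMetric gN gΛ hisom _ hP hP'
    fun x₀ V hV => SigmaManifold.contMDiffAt_average hself hS k hV
  refine ⟨cs, hm, hq, hM.mfderiv_tmul_surjective, g,
    hg.preservesMetric_tmul hM hisom hP', hg.isRiemannianSubmersion hM hP hP', ?_, fun x => ⟨?_, ?_⟩,
    hself, hS, fun y v => ?_, fun v => ?_⟩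
  · exact SigmaManifold.isOpenQuotientMap_tmul.surjective.connectedSpace
      (SigmaManifold.continuous_tmul (H := H) (Λ := Λ))
  -- The inverse of a symmetry is its power of exponent `k - 1`, so no separate smoothness argument
  -- for the inverse is needed.
  · obtain ⟨n, rfl⟩ : ∃ n, k = n + 1 := ⟨k - 1, by omega⟩
    have hsn : ∀ n : ℕ, ContMDiff 𝓘(ℝ, EN × EΛ) 𝓘(ℝ, EN × EΛ) ∞
        (SigmaManifold.assocMul σ H hHfix Λ x)^[n] := fun n => by
      induction n with
      | zero => exact contMDiff_id
      | succ n ih => rw [Function.iterate_succ']; exact (hs x).comp ih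
    refine ⟨⟨⟨SigmaManifold.assocMul σ H hHfix Λ x, (SigmaManifold.assocMul σ H hHfix Λ x)^[n],
      fun z => ?_, fun z => ?_⟩, hs x, hsn n⟩, rfl⟩
    · rw [← Function.iterate_succ_apply]
      exact congrFun (hit x) z
    · rw [← Function.iterate_succ_apply' (SigmaManifold.assocMul σ H hHfix Λ x)]
      exact congrFun (hit x) z
  · refine hg.preservesMetric hM hisom hP (hd x) ((hsN' _).mdifferentiable (by simp))
      (hsN (SigmaManifold.assocProj H Λ x)).2
      (SigmaManifold.assocProj_comp_assocMul hHfix x) (fun b => ?_) fun z v => ?_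
    · obtain ⟨a, u, rfl⟩ := SigmaManifold.exists_tmul x
      exact ⟨_, SigmaManifold.assocMul_comp_tmul hHfix a b u⟩
    · exact (SigmaManifold.map_average_of_comm k
        (SigmaManifold.tderiv_symmetry_comm hd z x) v).symm
  · rw [SigmaManifold.symmetryTensor_eq hself, SigmaManifold.symmetryTensor_eq hself]
    exact congrArg (Bundle.TotalSpace.mk _) (SigmaManifold.tderiv_symmetry_comm hd v.proj y v.2)
  · exact (SigmaManifold.symmetryTensor_iterate (E := EN × EΛ) hself k v.proj v.2).trans
      (congrArg (Bundle.TotalSpace.mk v.proj)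
        (SigmaManifold.fixedDeriv_iterate_eq_self (E := EN × EΛ) (hd _ _) (hself _) (hit _) v.2))
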